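/- Let $n\ge 2$ and let $(\mathcal S_0,\sigma)$ be a smooth ($C^\infty$, Hausdorff, without boundary) Riemannian manifold of dimension $n$ which is complete, i.e. complete as a metric space for the distance given by the infimum of the lengths of curves. Let $Q=\mathcal S_0\times\mathbb R_+$, where $\mathbb R_+=(0,\infty)$ with coordinate $t$, be equipped with either of the Lorentzian metrics $$d\bar s^2=-\frac{32(n-1)}{n^2}\,dt^2+\sigma_{ij}\,dx^i dx^j,\qquad d\tilde s^2=-\frac{32(n-1)}{n^2}\,dt^2+\frac1{n-1}\,t^{\frac4n-2}\,\sigma_{ij}\,dx^i dx^j,$$ time-oriented by $\partial/\partial t$. Then, for each of these two metrics, $Q$ is globally hyperbolic, i.e. strongly causal and such that all the causal diamonds $J^+(p)\cap J^-(q)$, $p,q\in Q$, are compact; and for every $\tau>0$ the slice $M_\tau=\{t=\tau\}$ is a Cauchy hypersurface, i.e. every inextendible future directed causal curve in $Q$ meets $M_\tau$ exactly once. Here a future directed causal curve is a locally Lipschitz curve, defined on an interval, whose velocity is a nonzero future directed causal vector at almost every parameter, and it is inextendible if it has neither a future nor a past endpoint in $Q$. -/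

import Mathlib

open Set Filter Topology MeasureTheory Manifold Bundle
open scoped ContDiff NNReal

/-! ### Time-oriented Lorentzian manifolds and their causal theory -/

section Causality

variable {E : Type*} [NormedAddCommGroup E] [NormedSpace ℝ E]
  {H : Type*} [TopologicalSpace H]

/-- A smooth Lorentzian metric of signature `(-,+,…,+)` on a manifold `M`, together with a time
orientation, given by a nowhere vanishing timelike vector field `T` (declared future directed). -/
structure TimeOrientedLorentzMetric (I : ModelWithCorners ℝ E H)
    (M : Type*) [TopologicalSpace M] [ChartedSpace H M] [IsManifold I ∞ M] where
  /-- The metric, a bilinear form on every tangent space. -/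
  form (p : M) : LinearMap.BilinForm ℝ (TangentSpace I p)
  symm (p : M) (v w : TangentSpace I p) : form p v w = form p w v
  /-- Smoothness: `p ↦ form p (X p) (Y p)` is smooth wherever the vector fields `X`, `Y` are. -/
  smooth (X Y : ∀ p : M, TangentSpace I p) (p : M)
    (hX : ContMDiffAt I I.tangent ∞ (fun q ↦ (⟨q, X q⟩ : TangentBundle I M)) p)
    (hY : ContMDiffAt I I.tangent ∞ (fun q ↦ (⟨q, Y q⟩ : TangentBundle I M)) p) :
    ContMDiffAt I 𝓘(ℝ) ∞ (fun q ↦ form q (X q) (Y q)) p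
  /-- The time-orienting vector field. -/
  T (p : M) : TangentSpace I p
  smooth_T : ContMDiff I I.tangent ∞ (fun q ↦ (⟨q, T q⟩ : TangentBundle I M))
  timelike_T (p : M) : form p (T p) (T p) < 0
  /-- Lorentzian signature: the form is positive definite on the orthogonal complement of the
  timelike vector `T p`. -/
  pos_of_orthogonal (p : M) (v : TangentSpace I p) (hv : v ≠ 0) (h : form p (T p) v = 0) :
    0 < form p v v

namespace TimeOrientedLorentzMetric

variable {I : ModelWithCorners ℝ E H} {M : Type*} [TopologicalSpace M] [ChartedSpace H M]
  [IsManifold I ∞ M] (g : TimeOrientedLorentzMetric I M)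

/-- Future directed causal (that is, timelike or lightlike) tangent vectors. -/
def IsFutureCausal (p : M) (v : TangentSpace I p) : Prop :=
  v ≠ 0 ∧ g.form p v v ≤ 0 ∧ g.form p (g.T p) v < 0

/-- `γ`, restricted to the interval `J` (of any kind, but not empty and not a single point), is a
future directed causal curve: a locally Lipschitz curve whose velocity is future directed causal at
almost every parameter. This comprises the piecewise `C¹` future directed causal curves. The values
of `γ` outside `J` are irrelevant. -/
structure IsCausalCurve (γ : ℝ → M) (J : Set ℝ) : Prop where
  ordConnected : J.OrdConnected
  nontrivial : J.Nontrivial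
  continuousOn : ContinuousOn γ J
  /-- Locally Lipschitz, read in the charts of `M`. -/
  locallyLipschitz : ∀ s ∈ J, ∃ K : ℝ≥0, ∃ u ∈ 𝓝[J] s,
    LipschitzOnWith K (fun r ↦ extChartAt I (γ s) (γ r)) u
  ae_futureCausal : ∀ᵐ s ∂(volume.restrict J), MDifferentiableAt 𝓘(ℝ, ℝ) I γ s ∧
    g.IsFutureCausal (γ s) (mfderiv 𝓘(ℝ, ℝ) I γ s (1 : ℝ))

/-- `p` is the future endpoint of `γ` restricted to `J`: `γ s → p` as `s` increases in `J`. -/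
def IsFutureEndpoint (γ : ℝ → M) (J : Set ℝ) (p : M) : Prop :=
  ∀ U ∈ 𝓝 p, ∃ s₀ ∈ J, ∀ s ∈ J, s₀ ≤ s → γ s ∈ U

/-- `p` is the past endpoint of `γ` restricted to `J`: `γ s → p` as `s` decreases in `J`. -/
def IsPastEndpoint (γ : ℝ → M) (J : Set ℝ) (p : M) : Prop :=
  ∀ U ∈ 𝓝 p, ∃ s₀ ∈ J, ∀ s ∈ J, s ≤ s₀ → γ s ∈ U

/-- An inextendible future directed causal curve: it has no endpoint in `M`. -/
def IsInextendibleCausalCurve (γ : ℝ → M) (J : Set ℝ) : Prop :=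
  g.IsCausalCurve γ J ∧ (¬ ∃ p : M, IsFutureEndpoint γ J p) ∧ ¬ ∃ p : M, IsPastEndpoint γ J p

/-- A Cauchy hypersurface: every inextendible causal curve meets it exactly once. -/
def IsCauchyHypersurface (C : Set M) : Prop :=
  ∀ (γ : ℝ → M) (J : Set ℝ), g.IsInextendibleCausalCurve γ J → ∃! s, s ∈ J ∧ γ s ∈ C

/-- The causal relation `p ≤ q`: either `p = q`, or there is a future directed causal curve from `p`
to `q`. -/
def CausalRel (p q : M) : Prop :=
  p = q ∨ ∃ (γ : ℝ → M) (a b : ℝ), a < b ∧ g.IsCausalCurve γ (Icc a b) ∧ γ a = p ∧ γ b = q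

/-- The causal future `J⁺(p)`. -/
def causalFuture (p : M) : Set M := {q | g.CausalRel p q}

/-- The causal past `J⁻(p)`. -/
def causalPast (p : M) : Set M := {q | g.CausalRel q p}

/-- Strong causality: every neighbourhood `U` of a point `p` contains a neighbourhood `V` of `p`
such that every causal curve starting and ending in `V` stays in `U`. -/
def StronglyCausal : Prop :=
  ∀ p : M, ∀ U ∈ 𝓝 p, ∃ V ∈ 𝓝 p, V ⊆ U ∧
    ∀ (γ : ℝ → M) (a b : ℝ), a < b → g.IsCausalCurve γ (Icc a b) → γ a ∈ V → γ b ∈ V →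
      ∀ s ∈ Icc a b, γ s ∈ U

/-- Global hyperbolicity: strong causality, and compactness of all the causal diamonds
`J⁺(p) ∩ J⁻(q)`. -/
def GloballyHyperbolic : Prop :=
  g.StronglyCausal ∧ ∀ p q : M, IsCompact (g.causalFuture p ∩ g.causalPast q)

end TimeOrientedLorentzMetric

end Causality

/-! ### The spacetime `S × ℝ₊` -/

section Product

/-- The half line `ℝ₊ = (0, ∞)`, as an open submanifold of `ℝ`. -/
abbrev PosHalfLine : TopologicalSpace.Opens ℝ := ⟨Ioi (0 : ℝ), isOpen_Ioi⟩

/-- The model with corners (without boundary) of the manifold `S × ℝ₊`, with `dim S = n`. -/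
noncomputable abbrev prodModel (n : ℕ) := (𝓡 n).prod 𝓘(ℝ, ℝ)

variable {n : ℕ} {S : Type*} [TopologicalSpace S] [ChartedSpace (EuclideanSpace ℝ (Fin n)) S]

/-- The differential `dt` of the coordinate function `t` on `S × ℝ₊`. -/
noncomputable def dTime (p : S × PosHalfLine) :
    TangentSpace (prodModel n) p →L[ℝ] ℝ :=
  mfderiv (prodModel n) 𝓘(ℝ, ℝ) (fun q : S × PosHalfLine ↦ (q.2 : ℝ)) p

/-- The differential `dx` of the projection of `S × ℝ₊` onto `S`. -/
noncomputable def dSpace (p : S × PosHalfLine) :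
    TangentSpace (prodModel n) p →L[ℝ] TangentSpace (𝓡 n) p.1 :=
  mfderiv (prodModel n) (𝓡 n) (fun q : S × PosHalfLine ↦ q.1) p

/-- The coordinate vector field `∂/∂t` on `S × ℝ₊`. -/
noncomputable def timeField (p : S × PosHalfLine) : TangentSpace (prodModel n) p :=
  mfderiv 𝓘(ℝ, ℝ) (prodModel n) (fun s : PosHalfLine ↦ ((p.1, s) : S × PosHalfLine)) p.2 (1 : ℝ)

/-- The charts of `ℝ₊` are given by the coordinate `t` itself. -/
lemma posHalfLine_chartAt_symm (s : PosHalfLine) (r : ℝ) (hr : r ∈ Ioi (0 : ℝ)) :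
    (((chartAt ℝ s).symm r : PosHalfLine) : ℝ) = r := by
  have h : (chartAt ℝ s) (⟨r, hr⟩ : PosHalfLine) = r := rfl
  have h2 := (chartAt ℝ s).left_inv (x := (⟨r, hr⟩ : PosHalfLine)) (by
    simp [TopologicalSpace.Opens.chartAt_eq, chartAt_self_eq])
  rw [h] at h2
  rw [h2]

/-- The inclusion `ℝ₊ → ℝ` has derivative `1`. -/
lemma hasMFDerivAt_coe_posHalfLine (s : PosHalfLine) :
    HasMFDerivAt 𝓘(ℝ, ℝ) 𝓘(ℝ, ℝ) (fun r : PosHalfLine ↦ (r : ℝ)) s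
      (ContinuousLinearMap.id ℝ ℝ) := by
  refine ⟨continuous_subtype_val.continuousAt, ?_⟩
  have h : writtenInExtChartAt 𝓘(ℝ, ℝ) 𝓘(ℝ, ℝ) s (fun r : PosHalfLine ↦ (r : ℝ))
      =ᶠ[𝓝 (s : ℝ)] id := by
    filter_upwards [isOpen_Ioi.mem_nhds s.2] with r hr
    exact posHalfLine_chartAt_symm s r hr
  have h' : HasFDerivWithinAt
      (writtenInExtChartAt 𝓘(ℝ, ℝ) 𝓘(ℝ, ℝ) s (fun r : PosHalfLine ↦ (r : ℝ)))
      (ContinuousLinearMap.id ℝ ℝ) (range 𝓘(ℝ, ℝ)) (s : ℝ) :=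
    ((hasFDerivAt_id (s : ℝ)).congr_of_eventuallyEq h).hasFDerivWithinAt
  exact h'

lemma dSpace_apply (p : S × PosHalfLine) (v : TangentSpace (prodModel n) p) :
    dSpace p v = (show EuclideanSpace ℝ (Fin n) × ℝ from v).1 := by
  simp only [dSpace, mfderiv_fst]
  rfl

lemma dTime_apply (p : S × PosHalfLine) (v : TangentSpace (prodModel n) p) :
    dTime p v = (show EuclideanSpace ℝ (Fin n) × ℝ from v).2 := by
  have := ((hasMFDerivAt_coe_posHalfLine p.2).comp p
    (hasMFDerivAt_snd (I := 𝓡 n) (I' := 𝓘(ℝ, ℝ)) p)).mfderiv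
  simp only [dTime]
  erw [this]
  rfl

lemma timeField_eq (p : S × PosHalfLine) :
    timeField p = (show TangentSpace (prodModel n) p from
      ((0, 1) : EuclideanSpace ℝ (Fin n) × ℝ)) := by
  simp only [timeField]
  have := (hasMFDerivAt_const (I := 𝓘(ℝ, ℝ)) (I' := 𝓡 n) p.1 p.2).prodMk
    (hasMFDerivAt_id (I := 𝓘(ℝ, ℝ)) p.2)
  erw [this.mfderiv]
  rfl

lemma contMDiff_unitField :
    ContMDiff 𝓘(ℝ, ℝ) 𝓘(ℝ, ℝ).tangent ∞
      (fun s : PosHalfLine ↦ (⟨s, (show TangentSpace 𝓘(ℝ, ℝ) s from (1 : ℝ))⟩ : TangentBundle 𝓘(ℝ, ℝ) PosHalfLine)) := by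
  intro s₀
  refine contMDiffAt_totalSpace.2 ⟨contMDiffAt_id, ?_⟩
  refine contMDiffAt_const (c := (1 : ℝ)) |>.congr_of_eventuallyEq (Eventually.of_forall fun s ↦ ?_)
  exact (tangentBundleCore 𝓘(ℝ, ℝ) PosHalfLine).coordChange_self
    (achart ℝ s) s (mem_chart_source ℝ s) (1 : ℝ)

lemma contMDiff_timeField [IsManifold (𝓡 n) ∞ S] :
    ContMDiff (prodModel n) (prodModel n).tangent ∞
      (fun p : S × PosHalfLine ↦
        (⟨p, timeField p⟩ : TangentBundle (prodModel n) (S × PosHalfLine))) := by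
  have h1 : ContMDiff (prodModel n) ((𝓡 n).tangent.prod 𝓘(ℝ, ℝ).tangent) ∞
      (fun p : S × PosHalfLine ↦ ((⟨p.1, 0⟩, ⟨p.2, (1 : ℝ)⟩) :
        TangentBundle (𝓡 n) S × TangentBundle 𝓘(ℝ, ℝ) PosHalfLine)) :=
    ((contMDiff_zeroSection ℝ (TangentSpace (𝓡 n) : S → Type _)).comp contMDiff_fst).prodMk
      (contMDiff_unitField.comp contMDiff_snd)
  have h2 := (contMDiff_equivTangentBundleProd_symm (I := 𝓡 n) (M := S) (I' := 𝓘(ℝ, ℝ))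
    (M' := PosHalfLine) (n := ∞)).comp h1
  refine h2.congr fun p ↦ ?_
  rw [timeField_eq]
  rfl

lemma contMDiffAt_dSpace_comp [IsManifold (𝓡 n) ∞ S]
    {X : ∀ p : S × PosHalfLine, TangentSpace (prodModel n) p} {p : S × PosHalfLine}
    (hX : ContMDiffAt (prodModel n) (prodModel n).tangent ∞
      (fun q ↦ (⟨q, X q⟩ : TangentBundle (prodModel n) (S × PosHalfLine))) p) :
    ContMDiffAt (prodModel n) (𝓡 n).tangent ∞
      (fun q ↦ (⟨q.1, dSpace q (X q)⟩ : TangentBundle (𝓡 n) S)) p := by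
  have h : ContMDiff (prodModel n).tangent (𝓡 n).tangent ∞
      (tangentMap (prodModel n) (𝓡 n) (fun q : S × PosHalfLine ↦ q.1)) :=
    contMDiff_fst.contMDiff_tangentMap (n := ∞) (m := ∞) (by simp)
  exact h.contMDiffAt.comp p hX

lemma contMDiffAt_dTime_comp [IsManifold (𝓡 n) ∞ S]
    {X : ∀ p : S × PosHalfLine, TangentSpace (prodModel n) p} {p : S × PosHalfLine}
    (hX : ContMDiffAt (prodModel n) (prodModel n).tangent ∞
      (fun q ↦ (⟨q, X q⟩ : TangentBundle (prodModel n) (S × PosHalfLine))) p) :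
    ContMDiffAt (prodModel n) 𝓘(ℝ, ℝ) ∞ (fun q ↦ dTime q (X q)) p := by
  have h : ContMDiff (prodModel n).tangent 𝓘(ℝ, ℝ).tangent ∞
      (tangentMap (prodModel n) 𝓘(ℝ, ℝ) (fun q : S × PosHalfLine ↦ (q.2 : ℝ))) :=
    (contMDiff_subtype_val.comp contMDiff_snd).contMDiff_tangentMap (n := ∞) (m := ∞) (by simp)
  have h2 := h.contMDiffAt.comp p hX
  have h3 := (contMDiffAt_totalSpace.1 h2).2
  simpa [Function.comp_def] using! h3

lemma dTime_timeField (p : S × PosHalfLine) : dTime p (timeField p : TangentSpace (prodModel n) p) = 1 := by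
  rw [dTime_apply, timeField_eq]

lemma dSpace_timeField (p : S × PosHalfLine) : dSpace p (timeField p : TangentSpace (prodModel n) p) = 0 := by
  rw [dSpace_apply, timeField_eq]
  rfl

variable [RiemannianBundle (fun x : S ↦ TangentSpace (𝓡 n) x)]

variable (S) in
/-- The bilinear form `-c dt² + f(t) σ` on `S × ℝ₊`, where `σ` is the Riemannian metric of `S`. -/
noncomputable def warpedForm (c : ℝ) (f : ℝ → ℝ) (p : S × PosHalfLine) :
    LinearMap.BilinForm ℝ (TangentSpace (prodModel n) p) :=
  LinearMap.mk₂ ℝ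
    (fun v w ↦ -c * (dTime p v * dTime p w) + f p.2 * inner ℝ (dSpace p v) (dSpace p w))
    (fun u v w ↦ by simp only [map_add, inner_add_left]; ring)
    (fun a v w ↦ by simp only [map_smul, real_inner_smul_left, smul_eq_mul]; ring)
    (fun u v w ↦ by simp only [map_add, inner_add_right]; ring)
    (fun a v w ↦ by simp only [map_smul, real_inner_smul_right, smul_eq_mul]; ring)

lemma warpedForm_apply (c : ℝ) (f : ℝ → ℝ) (p : S × PosHalfLine)
    (v w : TangentSpace (prodModel n) p) :
    warpedForm S c f p v w =
      -c * (dTime p v * dTime p w) + f p.2 * inner ℝ (dSpace p v) (dSpace p w) := rfl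

variable [IsManifold (𝓡 n) ∞ S] [IsContMDiffRiemannianBundle (𝓡 n) ∞ (EuclideanSpace ℝ (Fin n))
    (fun x : S ↦ TangentSpace (𝓡 n) x)]

variable (S) in
/-- The Lorentzian metric `-c dt² + f(t) σ` on `S × ℝ₊`, time-oriented by `∂/∂t`. -/
noncomputable def warpedMetric (c : ℝ) (hc : 0 < c) (f : ℝ → ℝ) (hf : ∀ t, 0 < t → 0 < f t)
    (hf' : ContDiffOn ℝ ∞ f (Ioi 0)) :
    TimeOrientedLorentzMetric (prodModel n) (S × PosHalfLine) where
  form := warpedForm S c f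
  symm p v w := by
    rw [warpedForm_apply, warpedForm_apply, real_inner_comm, mul_comm (dTime p v)]
  smooth X Y p hX hY := by
    simp only [warpedForm_apply]
    have hf2 : ContMDiffAt (prodModel n) 𝓘(ℝ) ∞ (fun q : S × PosHalfLine ↦ f q.2) p := by
      have h1 : ContMDiffAt 𝓘(ℝ, ℝ) 𝓘(ℝ, ℝ) ∞ f (p.2 : ℝ) :=
        (hf'.contDiffAt (isOpen_Ioi.mem_nhds p.2.2)).contMDiffAt
      exact h1.comp p (contMDiff_subtype_val.comp contMDiff_snd).contMDiffAt
    exact (contMDiffAt_const.mul ((contMDiffAt_dTime_comp hX).mul (contMDiffAt_dTime_comp hY))).add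
      (hf2.mul ((contMDiffAt_dSpace_comp hX).inner_bundle (contMDiffAt_dSpace_comp hY)))
  T := timeField
  smooth_T := contMDiff_timeField
  timelike_T p := by
    rw [warpedForm_apply, dTime_timeField, dSpace_timeField, inner_zero_left]
    linarith
  pos_of_orthogonal p v hv h := by
    rw [warpedForm_apply, dTime_timeField, dSpace_timeField, inner_zero_left] at h
    have h1 : dTime p v = 0 := by
      simpa [hc.ne'] using h
    have h2 : dSpace p v ≠ 0 := by
      intro h2
      apply hv
      rw [dTime_apply] at h1
      rw [dSpace_apply] at h2
      exact Prod.ext h2 h1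
    rw [warpedForm_apply, h1]
    have h3 := real_inner_self_pos.2 h2
    have h4 := hf p.2 p.2.2
    simp only [mul_zero, zero_add]
    exact mul_pos h4 h3

variable (S) in
/-- The metric `-(32 (n - 1) / n²) dt² + σ` on `Q = S × ℝ₊`. -/
noncomputable def metricQ (hn : 2 ≤ n) :
    TimeOrientedLorentzMetric (prodModel n) (S × PosHalfLine) :=
  warpedMetric S (32 * ((n : ℝ) - 1) / (n : ℝ) ^ 2)
    (by
      have : (2 : ℝ) ≤ n := by exact_mod_cast hn
      have : 0 < (n : ℝ) - 1 := by linarith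
      positivity)
    (fun _ ↦ 1) (fun _ _ ↦ one_pos) contDiffOn_const

variable (S) in
/-- The metric `-(32 (n - 1) / n²) dt² + (1 / (n - 1)) t ^ (4 / n - 2) σ` on `Q = S × ℝ₊`. -/
noncomputable def metricQTilde (hn : 2 ≤ n) :
    TimeOrientedLorentzMetric (prodModel n) (S × PosHalfLine) :=
  warpedMetric S (32 * ((n : ℝ) - 1) / (n : ℝ) ^ 2)
    (by
      have : (2 : ℝ) ≤ n := by exact_mod_cast hn
      have : 0 < (n : ℝ) - 1 := by linarith
      positivity)
    (fun t ↦ 1 / ((n : ℝ) - 1) * t ^ (4 / (n : ℝ) - 2))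
    (fun t ht ↦ by
      have : (2 : ℝ) ≤ n := by exact_mod_cast hn
      have : 0 < (n : ℝ) - 1 := by linarith
      positivity)
    (fun t ht ↦ ((contDiffAt_const (c := 1 / ((n : ℝ) - 1))).mul
      (Real.contDiffAt_rpow_const_of_ne (ne_of_gt ht))).contDiffWithinAt)

variable (S) in
/-- The slice `{t = τ}` of `S × ℝ₊`. -/
def timeSlice (τ : ℝ) : Set (S × PosHalfLine) := {q | (q.2 : ℝ) = τ}

end Product

/-! Both metrics have the form `-c dt² + f(t) σ`. Let `Φ` be a primitive of `√(c / f)`. Up to the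
conformal factor `f` the metric is `-dΦ² + σ`, so its causal cones are those of a product: `v` is
future causal iff `dt(v) > 0` and `|dx(v)| ≤ dΦ(v)` (`isFutureCausal_warpedMetric_iff`).

Integrating this bound shows that along a causal curve `t` increases strictly and the distance
travelled in `S` is at most the increase of `Φ ∘ t` (`lt_and_edist_le_of_isCausalCurve`).
Conversely, a minimal geodesic of `S` parametrized in proportion to `Φ` lifts to a causal curve.
Hence `p ≤ q` iff `t(p) ≤ t(q)` and `d(p.1, q.1) ≤ Φ(t(q)) - Φ(t(p))`
(`causalRel_warpedMetric_iff`). Diamonds are then closed subsets of a product of a closed ball,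
compact by Hopf–Rinow, and a compact interval of times. A causal curve whose time converges in `ℝ₊`
converges by completeness, so on an inextendible one `t` takes every value. The range of `Φ` plays
no role.

As curves are only locally Lipschitz, velocities are compared with distances through charts: near
its centre a chart distorts distances by a factor as close to `1` as desired, for the Riemannian
norm at the centre. Distances are extended, so `S` may be disconnected. -/

section MetricGeometry

open scoped ENNReal

set_option linter.unusedSectionVars false

/-! ### Velocities of curves read in a chart -/

section TangentChart

lemma IsContMDiffRiemannianBundle.isContinuousRiemannianBundle {EB : Type*} [NormedAddCommGroup EB]
    [NormedSpace ℝ EB] {HB : Type*} [TopologicalSpace HB] (IB : ModelWithCorners ℝ EB HB) (k : ℕ∞ω)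
    {B : Type*} [TopologicalSpace B] [ChartedSpace HB B]
    {F : Type*} [NormedAddCommGroup F] [NormedSpace ℝ F]
    {E : B → Type*} [TopologicalSpace (TotalSpace F E)]
    [∀ x, NormedAddCommGroup (E x)] [∀ x, InnerProductSpace ℝ (E x)]
    [FiberBundle F E] [VectorBundle ℝ F E] [h : IsContMDiffRiemannianBundle IB k F E] :
    IsContinuousRiemannianBundle F E := by
  obtain ⟨g, hg, hg'⟩ := h.exists_contMDiff
  exact ⟨g, hg.continuous, hg'⟩

variable {n : ℕ} {S : Type*} [EMetricSpace S] [ChartedSpace (EuclideanSpace ℝ (Fin n)) S]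
    [IsManifold (𝓡 n) ∞ S]
    [RiemannianBundle (fun x : S ↦ TangentSpace (𝓡 n) x)]
    [IsContinuousRiemannianBundle (EuclideanSpace ℝ (Fin n))
      (fun x : S ↦ TangentSpace (𝓡 n) x)]
    [IsRiemannianManifold (𝓡 n) S]

variable (n) in
/-- The chart at `x`, with values in the tangent space at `x` with its Riemannian norm. -/
noncomputable def tangentChart (x y : S) : TangentSpace (𝓡 n) x :=
  (trivializationAt (EuclideanSpace ℝ (Fin n)) (TangentSpace (𝓡 n)) x).symmL ℝ x
    (extChartAt (𝓡 n) x y)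

/-- Over its source, the differential of the chart at `x` is the trivialization of the tangent
bundle at `x`. -/
lemma hasDerivWithinAt_extChartAt_comp {x : S} {γ : ℝ → S} {s : Set ℝ} {t : ℝ}
    (hγ : MDifferentiableWithinAt 𝓘(ℝ, ℝ) (𝓡 n) γ s t)
    (ht : γ t ∈ (chartAt (EuclideanSpace ℝ (Fin n)) x).source) :
    HasDerivWithinAt (fun r ↦ extChartAt (𝓡 n) x (γ r))
        ((trivializationAt (EuclideanSpace ℝ (Fin n)) (TangentSpace (𝓡 n)) x).continuousLinearMapAt
          ℝ (γ t) (mfderivWithin 𝓘(ℝ, ℝ) (𝓡 n) γ s t (1 : ℝ))) s t := by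
  have h1 := (mdifferentiableAt_extChartAt (I := 𝓡 n) ht).hasMFDerivAt.comp_hasMFDerivWithinAt t
    hγ.hasMFDerivWithinAt
  have h3 := TangentBundle.continuousLinearMapAt_trivializationAt (I := 𝓡 n) ht
  let D : ℝ →L[ℝ] EuclideanSpace ℝ (Fin n) :=
    (mfderiv (𝓡 n) 𝓘(ℝ, EuclideanSpace ℝ (Fin n)) (extChartAt (𝓡 n) x) (γ t)).comp
      (mfderivWithin 𝓘(ℝ, ℝ) (𝓡 n) γ s t)
  have h2 : HasFDerivWithinAt (extChartAt (𝓡 n) x ∘ γ) D s t :=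
    hasMFDerivWithinAt_iff_hasFDerivWithinAt.1 h1
  convert! h2.hasDerivWithinAt using 1
  exact congr($h3 _)

lemma hasDerivWithinAt_tangentChart_comp {x : S} {γ : ℝ → S} {s : Set ℝ} {t : ℝ}
    (hγ : MDifferentiableWithinAt 𝓘(ℝ, ℝ) (𝓡 n) γ s t)
    (ht : γ t ∈ (chartAt (EuclideanSpace ℝ (Fin n)) x).source) :
    HasDerivWithinAt (fun r ↦ tangentChart n x (γ r))
      ((trivializationAt (EuclideanSpace ℝ (Fin n)) (TangentSpace (𝓡 n)) x).symmL ℝ x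
        ((trivializationAt (EuclideanSpace ℝ (Fin n)) (TangentSpace (𝓡 n)) x).continuousLinearMapAt
          ℝ (γ t) (mfderivWithin 𝓘(ℝ, ℝ) (𝓡 n) γ s t (1 : ℝ)))) s t := by
  let L := (trivializationAt (EuclideanSpace ℝ (Fin n)) (TangentSpace (𝓡 n)) x).symmL ℝ x
  exact L.hasFDerivAt.comp_hasDerivWithinAt t (hasDerivWithinAt_extChartAt_comp hγ ht)

end TangentChart

/-! ### Charts are almost isometric near their centre -/

section ChartComparison

variable {n : ℕ} {S : Type*} [EMetricSpace S] [ChartedSpace (EuclideanSpace ℝ (Fin n)) S]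
    [IsManifold (𝓡 n) ∞ S]
    [RiemannianBundle (fun x : S ↦ TangentSpace (𝓡 n) x)]
    [IsContinuousRiemannianBundle (EuclideanSpace ℝ (Fin n))
      (fun x : S ↦ TangentSpace (𝓡 n) x)]
    [IsRiemannianManifold (𝓡 n) S]

lemma edist_le_pathELength {γ : ℝ → S} {a b : ℝ} (hγ : ContMDiffOn 𝓘(ℝ, ℝ) (𝓡 n) 1 γ (Icc a b))
    (hab : a ≤ b) : edist (γ a) (γ b) ≤ pathELength (𝓡 n) γ a b := by
  rw [IsRiemannianManifold.out (I := 𝓡 n)]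
  exact riemannianEDist_le_pathELength hγ rfl rfl hab

/-- Near `x`, the chart at `x` is almost nonexpanding, for the Riemannian norm at `x`. -/
lemma eventually_edist_tangentChart_le (x : S) {r : ℝ≥0} (hr : 1 < r) :
    ∀ᶠ p : S × S in 𝓝 (x, x),
      edist (tangentChart n x p.1) (tangentChart n x p.2) ≤ r * edist p.1 p.2 := by
  have h1 := eventually_norm_symmL_trivializationAt_self_comp_lt (EuclideanSpace ℝ (Fin n))
    (E := (fun x : S ↦ TangentSpace (𝓡 n) x)) x (NNReal.coe_lt_coe.2 hr)
  obtain ⟨ε, ε0, hε⟩ := EMetric.mem_nhds_iff.1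
    (inter_mem h1 (chart_source_mem_nhds (EuclideanSpace ℝ (Fin n)) x))
  -- A path of length less than `2δ` that starts within `δ` of `x` stays within `3δ ≤ ε` of `x`,
  -- hence in the good neighbourhood.
  obtain ⟨δ, δ0, hδ⟩ : ∃ δ : ℝ≥0∞, 0 < δ ∧ δ + (δ + δ) ≤ ε := by
    refine ⟨ε / 3, ENNReal.div_pos ε0.ne' (by simp), ?_⟩
    rw [← add_assoc, ENNReal.add_thirds]
  rw [nhds_prod_eq]
  filter_upwards [prod_mem_prod (Metric.eball_mem_nhds x δ0) (Metric.eball_mem_nhds x δ0)]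
  rintro ⟨y, z⟩ ⟨hy, hz⟩
  simp only [Metric.mem_eball] at hy hz
  have hyz : edist y z < δ + δ :=
    (edist_triangle_right y z x).trans_lt (ENNReal.add_lt_add hy hz)
  have key : ∀ R, edist y z < R → R < δ + δ →
      edist (tangentChart n x y) (tangentChart n x z) ≤ r * R := by
    intro R hR hRδ
    rw [IsRiemannianManifold.out (I := 𝓡 n)] at hR
    obtain ⟨γ, rfl, rfl, hγ, hγR⟩ := exists_lt_of_riemannianEDist_lt hR
    have hmem : ∀ t ∈ Icc (0 : ℝ) 1, γ t ∈ Metric.eball x ε := by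
      intro t ht
      have h2 : edist (γ 0) (γ t) < δ + δ := by
        refine (edist_le_pathELength (hγ.mono (Icc_subset_Icc le_rfl ht.2)) ht.1).trans_lt ?_
        exact (pathELength_mono le_rfl ht.2).trans_lt (hγR.trans hRδ)
      rw [Metric.mem_eball, edist_comm]
      refine (edist_triangle x (γ 0) (γ t)).trans_lt (lt_of_lt_of_le ?_ hδ)
      rw [edist_comm]
      exact ENNReal.add_lt_add hy h2
    have hd : ∀ t ∈ Icc (0 : ℝ) 1, _ := fun t ht ↦ hasDerivWithinAt_tangentChart_comp
      ((hγ.mdifferentiableOn one_ne_zero) t ht) (hε (hmem t ht)).2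
    have hC : ContDiffOn ℝ 1 (fun t ↦ tangentChart n x (γ t)) (Icc 0 1) := by
      refine (ContinuousLinearMap.contDiff _).comp_contDiffOn ?_
      rw [← contMDiffOn_iff_contDiffOn]
      exact contMDiffOn_extChartAt.comp hγ fun t ht ↦ (hε (hmem t ht)).2
    rw [edist_comm, edist_eq_enorm_sub]
    refine (enorm_sub_le_lintegral_derivWithin_Icc_of_contDiffOn_Icc hC zero_le_one).trans ?_
    calc _ ≤ ∫⁻ t in Icc (0 : ℝ) 1, r * ‖mfderivWithin 𝓘(ℝ, ℝ) (𝓡 n) γ (Icc 0 1) t (1 : ℝ)‖ₑ := by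
          refine setLIntegral_mono' measurableSet_Icc fun t ht ↦ ?_
          rw [(hd t ht).derivWithin (uniqueDiffOn_Icc zero_lt_one t ht)]
          have h3 := (hε (hmem t ht)).1
          let L := ((trivializationAt (EuclideanSpace ℝ (Fin n)) (TangentSpace (𝓡 n)) x).symmL ℝ x).comp
            ((trivializationAt (EuclideanSpace ℝ (Fin n)) (TangentSpace (𝓡 n)) x).continuousLinearMapAt
              ℝ (γ t))
          -- `L` maps the tangent space at `γ t` to the one at `x`, each with its own norm; by the
          -- choice of `ε` its operator norm is less than `r`.
          refine (L.le_opENorm (mfderivWithin 𝓘(ℝ, ℝ) (𝓡 n) γ (Icc 0 1) t (1 : ℝ))).trans ?_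
          gcongr
          rw [← ofReal_norm, ← ENNReal.ofReal_coe_nnreal]
          exact ENNReal.ofReal_le_ofReal h3.le
      _ = r * pathELength (𝓡 n) γ 0 1 := by
          rw [lintegral_const_mul' _ _ ENNReal.coe_ne_top, pathELength_eq_lintegral_mfderivWithin_Icc]
          rfl
      _ ≤ r * R := by gcongr
  have hr0 : (r : ℝ≥0∞) ≠ 0 := by simpa using (zero_lt_one.trans hr).ne'
  rw [mul_comm, ← ENNReal.div_le_iff hr0 ENNReal.coe_ne_top]
  refine le_of_forall_gt_imp_ge_of_dense fun R hR ↦ ?_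
  obtain ⟨R', h1, h2⟩ := exists_between (lt_min hR hyz)
  rw [ENNReal.div_le_iff hr0 ENNReal.coe_ne_top, mul_comm]
  refine (key R' h1 (h2.trans_le (min_le_right _ _))).trans ?_
  gcongr
  exact h2.le.trans (min_le_left _ _)

lemma tendsto_extChartAt_symm (x : S) :
    Tendsto (fun v : EuclideanSpace ℝ (Fin n) ↦ (extChartAt (𝓡 n) x).symm v)
      (𝓝 (extChartAt (𝓡 n) x x)) (𝓝 x) := by
  have := continuousAt_extChartAt_symm (I := 𝓡 n) x
  rwa [ContinuousAt, extChartAt_to_inv] at this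

/-- Near `x`, the inverse of the chart at `x` is almost nonexpanding, for the Riemannian norm at
`x`. -/
lemma eventually_edist_le_edist_tangentChart (x : S) {r : ℝ≥0} (hr : 1 < r) :
    ∀ᶠ p : S × S in 𝓝 (x, x),
      edist p.1 p.2 ≤ r * edist (tangentChart n x p.1) (tangentChart n x p.2) := by
  have h1 := eventually_norm_symmL_trivializationAt_comp_self_lt (EuclideanSpace ℝ (Fin n))
    (E := (fun x : S ↦ TangentSpace (𝓡 n) x)) x (NNReal.coe_lt_coe.2 hr)
  have h2 : ∀ᶠ v in 𝓝 (extChartAt (𝓡 n) x x), _ :=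
    (tendsto_extChartAt_symm x).eventually
      (inter_mem h1 (chart_source_mem_nhds (EuclideanSpace ℝ (Fin n)) x))
  obtain ⟨ε, ε0, hε⟩ := Metric.mem_nhds_iff.1
    (inter_mem h2 (extChartAt_target_mem_nhds (I := 𝓡 n) x))
  have h3 : ∀ᶠ y in 𝓝 x, extChartAt (𝓡 n) x y ∈ Metric.ball (extChartAt (𝓡 n) x x) ε :=
    (continuousAt_extChartAt (I := 𝓡 n) x).eventually (Metric.ball_mem_nhds _ ε0)
  have h4 : {y | extChartAt (𝓡 n) x y ∈ Metric.ball (extChartAt (𝓡 n) x x) ε} ∩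
    (extChartAt (𝓡 n) x).source ∈ 𝓝 x := inter_mem h3 (extChartAt_source_mem_nhds x)
  rw [nhds_prod_eq]
  filter_upwards [prod_mem_prod h4 h4]
  rintro ⟨y, z⟩ ⟨⟨hy, hy'⟩, hz, hz'⟩
  dsimp only at hy hz hy' hz' ⊢
  -- The distance is bounded by the length of the preimage of the straight segment between the two
  -- chart points. That segment stays in a ball of the model space, by convexity.
  let η : ℝ →ᴬ[ℝ] EuclideanSpace ℝ (Fin n) :=
    ContinuousAffineMap.lineMap (extChartAt (𝓡 n) x y) (extChartAt (𝓡 n) x z)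
  let γ : ℝ → S := fun t ↦ (extChartAt (𝓡 n) x).symm (η t)
  have hη : ∀ t ∈ Icc (0 : ℝ) 1, η t ∈ Metric.ball (extChartAt (𝓡 n) x x) ε := fun t ht ↦
    (convex_ball _ _).lineMap_mem hy hz ht
  have hγ : ContMDiffOn 𝓘(ℝ, ℝ) (𝓡 n) 1 γ (Icc 0 1) := by
    refine (contMDiffOn_extChartAt_symm x).comp (t := (extChartAt (𝓡 n) x).target) ?_
      fun t ht ↦ (hε (hη t ht)).2
    exact η.contDiff.contMDiff.contMDiffOn
  have hγ0 : γ 0 = y := by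
    simp only [γ, η, ContinuousAffineMap.coe_lineMap_eq, AffineMap.lineMap_apply_zero]
    exact (extChartAt (𝓡 n) x).left_inv hy'
  have hγ1 : γ 1 = z := by
    simp only [γ, η, ContinuousAffineMap.coe_lineMap_eq, AffineMap.lineMap_apply_one]
    exact (extChartAt (𝓡 n) x).left_inv hz'
  have hd : ∀ t ∈ Icc (0 : ℝ) 1,
      ‖mfderivWithin 𝓘(ℝ, ℝ) (𝓡 n) γ (Icc 0 1) t (1 : ℝ)‖ₑ ≤
        r * edist (tangentChart n x y) (tangentChart n x z) := by
    intro t ht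
    obtain ⟨h5, h6⟩ := (hε (hη t ht)).1
    have h7 := hasDerivWithinAt_extChartAt_comp (x := x) (hγ.mdifferentiableOn one_ne_zero t ht) h6
    have h8 : HasDerivWithinAt (fun r ↦ extChartAt (𝓡 n) x (γ r))
        (extChartAt (𝓡 n) x z - extChartAt (𝓡 n) x y) (Icc 0 1) t := by
      have : HasDerivWithinAt η (extChartAt (𝓡 n) x z - extChartAt (𝓡 n) x y) (Icc 0 1) t :=
        AffineMap.hasDerivWithinAt_lineMap
      refine this.congr_of_mem (fun u hu ↦ ?_) ht
      exact (extChartAt (𝓡 n) x).right_inv (hε (hη u hu)).2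
    have h9 := (uniqueDiffOn_Icc zero_lt_one t ht).eq_deriv _ h7 h8
    have h10 := Trivialization.symmL_continuousLinearMapAt (R := ℝ)
      (trivializationAt (EuclideanSpace ℝ (Fin n)) (TangentSpace (𝓡 n)) x) (b := γ t) h6
      (mfderivWithin 𝓘(ℝ, ℝ) (𝓡 n) γ (Icc 0 1) t (1 : ℝ))
    rw [← h10, h9]
    have h11 := Trivialization.continuousLinearMapAt_symmL (R := ℝ)
      (trivializationAt (EuclideanSpace ℝ (Fin n)) (TangentSpace (𝓡 n)) x) (b := x)
      (mem_chart_source _ x) (extChartAt (𝓡 n) x z - extChartAt (𝓡 n) x y)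
    rw [← h11, map_sub]
    rw [edist_comm, edist_eq_enorm_sub]
    let L := ((trivializationAt (EuclideanSpace ℝ (Fin n)) (TangentSpace (𝓡 n)) x).symmL ℝ (γ t)).comp
      ((trivializationAt (EuclideanSpace ℝ (Fin n)) (TangentSpace (𝓡 n)) x).continuousLinearMapAt ℝ x)
    refine (L.le_opENorm (tangentChart n x z - tangentChart n x y)).trans ?_
    gcongr
    rw [← ofReal_norm, ← ENNReal.ofReal_coe_nnreal]
    exact ENNReal.ofReal_le_ofReal h5.le
  have h12 := edist_le_pathELength hγ zero_le_one
  rw [hγ0, hγ1] at h12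
  refine h12.trans ?_
  rw [pathELength_eq_lintegral_mfderivWithin_Icc]
  refine (setLIntegral_mono' measurableSet_Icc hd).trans ?_
  simp

end ChartComparison

/-! ### Length spaces, Hopf–Rinow and minimal geodesics -/

section LengthSpaces

section LengthSpace

variable {X : Type*} [EMetricSpace X]

variable (X) in
/-- Any two points at distance less than `R` are joined by an `R`-Lipschitz curve defined on
`[0, 1]`: the distance is the infimum of the lengths of the curves. -/
def IsLengthSpace : Prop :=
  ∀ (x y : X) (R : ℝ≥0), edist x y < R →
    ∃ ζ : ℝ → X, ζ 0 = x ∧ ζ 1 = y ∧ LipschitzOnWith R ζ (Icc 0 1)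

/-- On an `R`-Lipschitz curve from `x` to `y` with `r < R < r + δ`, the point at parameter `r / R`
works. -/
lemma IsLengthSpace.exists_edist_le_edist_lt (hX : IsLengthSpace X) {x y : X} {r δ : ℝ≥0}
    (hδ : 0 < δ) (h : edist x y < (r + δ : ℝ≥0)) : ∃ z, edist x z ≤ r ∧ edist z y < δ := by
  obtain ⟨R, hR, hRδ⟩ := ENNReal.lt_iff_exists_nnreal_btwn.1 h
  rw [ENNReal.coe_lt_coe] at hRδ
  rcases le_or_gt R r with hRr | hRr
  · exact ⟨y, hR.le.trans (by exact_mod_cast hRr), by simpa using hδ⟩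
  obtain ⟨ζ, rfl, rfl, hζ⟩ := hX x y R hR
  have hR0 : 0 < R := (zero_le (a := r)).trans_lt hRr
  have hs1 : (r / R : ℝ≥0) ≤ 1 := by rw [div_le_one hR0]; exact hRr.le
  have hs : ((r / R : ℝ≥0) : ℝ) ∈ Icc (0 : ℝ) 1 := ⟨NNReal.coe_nonneg _, by exact_mod_cast hs1⟩
  refine ⟨ζ (r / R : ℝ≥0), ?_, ?_⟩
  · refine (hζ (by simp) hs).trans_eq ?_
    rw [edist_dist, dist_zero_left, Real.norm_of_nonneg hs.1, ENNReal.ofReal_coe_nnreal,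
      ← ENNReal.coe_mul, mul_div_cancel₀ _ hR0.ne']
  · refine (hζ hs (by simp)).trans_lt ?_
    rw [edist_dist, Real.dist_eq, abs_sub_comm, abs_of_nonneg (by linarith [hs.2]),
      show (1 : ℝ) - (r / R : ℝ≥0) = ((1 - r / R : ℝ≥0) : ℝ) by rw [NNReal.coe_sub hs1]; simp,
      ENNReal.ofReal_coe_nnreal, ← ENNReal.coe_mul, ENNReal.coe_lt_coe, mul_tsub, mul_one,
      mul_div_cancel₀ _ hR0.ne']
    exact (tsub_lt_iff_left hRr.le).2 hRδ

/-- The Hopf–Rinow–Cohn-Vossen theorem: closed balls of finite radius are compact in a complete,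
locally compact length space. -/
theorem IsLengthSpace.isCompact_closedEBall [CompleteSpace X] [LocallyCompactSpace X]
    (hX : IsLengthSpace X) (x : X) (R : ℝ≥0) : IsCompact (Metric.closedEBall x R) := by
  by_contra hR
  let A : Set ℝ≥0 := {r | IsCompact (Metric.closedEBall x r)}
  have hA : ∀ r ∈ A, ∀ r' ≤ r, r' ∈ A := fun r hr r' hr' ↦
    hr.of_isClosed_subset Metric.isClosed_closedEBall
      (Metric.closedEBall_subset_closedEBall (by exact_mod_cast hr'))
  have hAb : BddAbove A := ⟨R, fun r hr ↦ le_of_not_ge fun h ↦ hR (hA r hr R h)⟩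
  have h0 : (0 : ℝ≥0) ∈ A := by simp [A]
  let ρ := sSup A
  have hlt : ∀ r < ρ, r ∈ A := fun r hr ↦ by
    obtain ⟨r', hr', h⟩ := exists_lt_of_lt_csSup ⟨0, h0⟩ hr
    exact hA r' hr' r h.le
  -- The supremum is attained: every point of the ball of radius `ρ` is within `δ < ε / 2` of the
  -- compact ball of radius `ρ - δ / 2`, so a finite `δ`-net of the latter is an `ε`-net of the
  -- former. Truncated subtraction is harmless, since `ρ < ρ - δ / 2 + δ` in all cases.
  have hρ : ρ ∈ A := by
    refine isCompact_iff_totallyBounded_isComplete.2 ⟨?_, Metric.isClosed_closedEBall.isComplete⟩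
    rw [EMetric.totallyBounded_iff]
    intro ε ε0
    obtain ⟨δ, δ0, hδ⟩ := ENNReal.lt_iff_exists_nnreal_btwn.1 (ENNReal.half_pos ε0.ne')
    have δ0' : 0 < δ := by simpa using δ0
    have hK : ρ - δ / 2 ∈ A := by
      rcases eq_or_ne ρ 0 with h | h
      · rw [h, zero_tsub]; exact h0
      · exact hlt _ (tsub_lt_self (pos_iff_ne_zero.2 h) (by positivity))
    obtain ⟨t, ht, hcov⟩ := EMetric.totallyBounded_iff.1 hK.totallyBounded _ δ0
    refine ⟨t, ht, fun y hy ↦ ?_⟩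
    have hy' : edist x y < (ρ - δ / 2 + δ : ℝ≥0) := by
      rw [Metric.mem_closedEBall, edist_comm] at hy
      refine hy.trans_lt ?_
      rw [ENNReal.coe_lt_coe]
      refine (le_tsub_add (b := ρ) (a := δ / 2)).trans_lt ?_
      gcongr
      exact NNReal.half_lt_self δ0'.ne'
    obtain ⟨z, hz, hzy⟩ := hX.exists_edist_le_edist_lt δ0' hy'
    have hz' : z ∈ Metric.closedEBall x (ρ - δ / 2 : ℝ≥0) := by
      rwa [Metric.mem_closedEBall, edist_comm]
    obtain ⟨w, hw, hzw⟩ := mem_iUnion₂.1 (hcov hz')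
    refine mem_iUnion₂.2 ⟨w, hw, ?_⟩
    rw [Metric.mem_eball] at hzw ⊢
    calc edist y w ≤ edist z y + edist z w := by rw [edist_comm z y]; exact edist_triangle _ _ _
      _ < δ + δ := ENNReal.add_lt_add hzy hzw
      _ ≤ ε := by rw [← ENNReal.add_halves ε]; gcongr
  -- By local compactness a thickening of the compact ball lies in a compact set, so a larger ball
  -- is compact too, against the choice of `ρ`.
  obtain ⟨L, hL, hKL⟩ := exists_compact_superset hρ
  obtain ⟨δ, δ0, hδ⟩ := hρ.exists_cthickening_subset_open isOpen_interior hKL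
  lift δ to ℝ≥0 using δ0.le
  have δ0' : 0 < δ := by exact_mod_cast δ0
  have hmem : ρ + δ / 2 ∈ A := by
    refine hL.of_isClosed_subset Metric.isClosed_closedEBall fun y hy ↦ interior_subset (hδ ?_)
    rw [Metric.mem_closedEBall, edist_comm] at hy
    have hy' : edist x y < (ρ + δ : ℝ≥0) := by
      refine hy.trans_lt ?_
      rw [ENNReal.coe_lt_coe]
      gcongr
      exact NNReal.half_lt_self δ0'.ne'
    obtain ⟨z, hz, hzy⟩ := hX.exists_edist_le_edist_lt δ0' hy'
    refine Metric.mem_cthickening_of_edist_le y z _ _ (by rwa [Metric.mem_closedEBall, edist_comm]) ?_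
    rw [edist_comm, ENNReal.ofReal_coe_nnreal]
    exact hzy.le
  have := le_csSup hAb hmem
  have h2 : ρ < ρ + δ / 2 := lt_add_of_pos_right _ (by positivity)
  exact absurd this (not_le.2 h2)

/-- Minimal geodesics exist in a complete, locally compact length space. -/
theorem IsLengthSpace.exists_lipschitzOnWith [CompleteSpace X] [LocallyCompactSpace X]
    (hX : IsLengthSpace X) {x y : X} {R : ℝ≥0} (h : edist x y ≤ R) :
    ∃ ζ : ℝ → X, ζ 0 = x ∧ ζ 1 = y ∧ LipschitzOnWith R ζ (Icc 0 1) := by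
  obtain ⟨u, -, hu, hu'⟩ := exists_seq_strictAnti_tendsto R
  choose ζ h0 h1 hζ using fun k ↦ hX x y (u k) (h.trans_lt (by exact_mod_cast hu k))
  -- In place of Arzelà–Ascoli: along a single ultrafilter all the sequences `ζ k s` converge at
  -- once, as they eventually stay in a compact ball. The Lipschitz constants `u k` decrease to `R`.
  let 𝒰 : Ultrafilter ℕ := Ultrafilter.of atTop
  have h𝒰 : (𝒰 : Filter ℕ) ≤ atTop := Ultrafilter.of_le atTop
  have hlim : ∀ s ∈ Icc (0 : ℝ) 1, ∃ z, Tendsto (fun k ↦ ζ k s) 𝒰 (𝓝 z) := by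
    intro s hs
    have hev : ∀ᶠ k in atTop, ζ k s ∈ Metric.closedEBall x (R + 1 : ℝ≥0) := by
      filter_upwards [hu'.eventually (gt_mem_nhds (lt_add_one R))] with k hk
      rw [Metric.mem_closedEBall, ← h0 k]
      refine (hζ k hs (by simp)).trans ?_
      calc _ ≤ (u k : ℝ≥0∞) * 1 := by
            gcongr
            rw [edist_dist, dist_zero_right, Real.norm_of_nonneg hs.1]
            exact ENNReal.ofReal_le_one.2 hs.2
        _ ≤ _ := by rw [mul_one]; exact_mod_cast hk.le
    obtain ⟨z, -, hz⟩ := (hX.isCompact_closedEBall x (R + 1)).ultrafilter_le_nhds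
      (𝒰.map fun k ↦ ζ k s) (le_principal_iff.2 (h𝒰 hev))
    exact ⟨z, hz⟩
  have : Nonempty X := ⟨x⟩
  choose! z hz using hlim
  refine ⟨z, ?_, ?_, fun s hs s' hs' ↦ ?_⟩
  · exact tendsto_nhds_unique (hz 0 (by simp)) (by simp only [h0]; exact tendsto_const_nhds)
  · exact tendsto_nhds_unique (hz 1 (by simp)) (by simp only [h1]; exact tendsto_const_nhds)
  · refine le_of_tendsto_of_tendsto' ((hz s hs).edist (hz s' hs')) ?_ fun k ↦ hζ k hs hs'
    exact ENNReal.Tendsto.mul_const (ENNReal.tendsto_coe.2 (hu'.mono_left h𝒰))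
      (Or.inr (edist_ne_top _ _))

end LengthSpace

variable {n : ℕ} {S : Type*} [EMetricSpace S] [ChartedSpace (EuclideanSpace ℝ (Fin n)) S]
    [IsManifold (𝓡 n) ∞ S]
    [RiemannianBundle (fun x : S ↦ TangentSpace (𝓡 n) x)]
    [IsContinuousRiemannianBundle (EuclideanSpace ℝ (Fin n))
      (fun x : S ↦ TangentSpace (𝓡 n) x)]
    [IsRiemannianManifold (𝓡 n) S]

/-- This is absolute continuity of the integral of the speed. -/
lemma continuousOn_pathELength {γ : ℝ → S} (h : pathELength (𝓡 n) γ 0 1 ≠ ⊤) :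
    ContinuousOn (fun t ↦ (pathELength (𝓡 n) γ 0 t).toReal) (Icc 0 1) := by
  have hfin : ∀ t ∈ Icc (0 : ℝ) 1, pathELength (𝓡 n) γ 0 t ≠ ⊤ := fun t ht ↦
    ne_top_of_le_ne_top h (pathELength_mono le_rfl ht.2)
  rw [Metric.continuousOn_iff]
  intro s hs ε ε0
  rw [pathELength_eq_lintegral_mfderiv_Icc] at h
  obtain ⟨δ, δ0, hδ⟩ := exists_pos_setLIntegral_lt_of_measure_lt h
    (ENNReal.ofReal_pos.2 ε0).ne'
  obtain ⟨d, d0, hd⟩ := ENNReal.lt_iff_exists_nnreal_btwn.1 δ0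
  have d0' : 0 < d := by simpa using d0
  have key : ∀ a ∈ Icc (0 : ℝ) 1, ∀ b ∈ Icc (0 : ℝ) 1, a ≤ b → b - a < d →
      (pathELength (𝓡 n) γ 0 b).toReal - (pathELength (𝓡 n) γ 0 a).toReal < ε ∧
      (pathELength (𝓡 n) γ 0 a).toReal ≤ (pathELength (𝓡 n) γ 0 b).toReal := by
    intro a ha b hb hab hlt
    have h1 := pathELength_add (I := 𝓡 n) (γ := γ) ha.1 hab
    have h2 : pathELength (𝓡 n) γ a b < ENNReal.ofReal ε := by
      have h3 := hδ (Icc a b) (by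
        refine (Measure.restrict_apply_le _ _).trans_lt (lt_of_le_of_lt ?_ hd)
        rw [Real.volume_Icc, ← ENNReal.ofReal_coe_nnreal]
        exact ENNReal.ofReal_le_ofReal hlt.le)
      rwa [Measure.restrict_restrict measurableSet_Icc,
        inter_eq_left.2 (Icc_subset_Icc ha.1 hb.2), ← pathELength_eq_lintegral_mfderiv_Icc] at h3
    rw [← h1, ENNReal.toReal_add (hfin a ha) h2.ne_top]
    have h4 := ENNReal.toReal_lt_of_lt_ofReal h2
    have h5 := ENNReal.toReal_nonneg (a := pathELength (𝓡 n) γ a b)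
    constructor <;> linarith
  refine ⟨d, by exact_mod_cast d0', fun t ht htd ↦ ?_⟩
  rw [Real.dist_eq] at htd ⊢
  obtain ⟨h6, h7⟩ := abs_lt.1 htd
  rcases le_total s t with hst | hst
  · obtain ⟨h8, h9⟩ := key s hs t ht hst (by linarith)
    rw [abs_of_nonneg] <;> linarith
  · obtain ⟨h8, h9⟩ := key t ht s hs hst (by linarith)
    rw [abs_sub_comm, abs_of_nonneg] <;> linarith

/-- Riemannian manifolds are length spaces. -/
theorem isLengthSpace_of_isRiemannianManifold (n : ℕ) (S : Type*) [EMetricSpace S]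
    [ChartedSpace (EuclideanSpace ℝ (Fin n)) S] [IsManifold (𝓡 n) ∞ S]
    [RiemannianBundle (fun x : S ↦ TangentSpace (𝓡 n) x)]
    [IsContinuousRiemannianBundle (EuclideanSpace ℝ (Fin n)) (fun x : S ↦ TangentSpace (𝓡 n) x)]
    [IsRiemannianManifold (𝓡 n) S] : IsLengthSpace S := by
  intro x y R hR
  rw [IsRiemannianManifold.out (I := 𝓡 n)] at hR
  obtain ⟨γ, rfl, rfl, hγ, hγR⟩ := exists_lt_of_riemannianEDist_lt hR
  let l : ℝ → ℝ := fun t ↦ (pathELength (𝓡 n) γ 0 t).toReal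
  have hfin : ∀ t ∈ Icc (0 : ℝ) 1, pathELength (𝓡 n) γ 0 t ≠ ⊤ := fun t ht ↦
    ne_top_of_le_ne_top hγR.ne_top (pathELength_mono le_rfl ht.2)
  have hl : ContinuousOn l (Icc 0 1) := continuousOn_pathELength hγR.ne_top
  have hl0 : l 0 = 0 := by simp [l]
  have hdist : ∀ a ∈ Icc (0 : ℝ) 1, ∀ b ∈ Icc (0 : ℝ) 1,
      edist (γ a) (γ b) ≤ ENNReal.ofReal |l a - l b| := by
    have key : ∀ a ∈ Icc (0 : ℝ) 1, ∀ b ∈ Icc (0 : ℝ) 1, a ≤ b →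
        edist (γ a) (γ b) ≤ ENNReal.ofReal |l a - l b| := by
      intro a ha b hb hab
      refine (edist_le_pathELength (hγ.mono (Icc_subset_Icc ha.1 hb.2)) hab).trans ?_
      have h1 := pathELength_add (I := 𝓡 n) (γ := γ) ha.1 hab
      have h2 : pathELength (𝓡 n) γ a b ≠ ⊤ := by
        intro h
        rw [h, add_top] at h1
        exact hfin b hb h1.symm
      have h3 : l b = l a + (pathELength (𝓡 n) γ a b).toReal := by
        simp only [l, ← h1]
        exact ENNReal.toReal_add (hfin a ha) h2
      rw [h3, abs_sub_comm, add_sub_cancel_left, abs_of_nonneg ENNReal.toReal_nonneg,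
        ENNReal.ofReal_toReal h2]
    intro a ha b hb
    rcases le_total a b with hab | hab
    · exact key a ha b hb hab
    · rw [edist_comm, abs_sub_comm]; exact key b hb a ha hab
  have hl1 : 0 ≤ l 1 := ENNReal.toReal_nonneg
  have hsurj : ∀ s ∈ Icc (0 : ℝ) 1, ∃ t ∈ Icc (0 : ℝ) 1, l t = s * l 1 := by
    intro s hs
    refine intermediate_value_Icc zero_le_one hl ⟨?_, ?_⟩
    · rw [hl0]; exact mul_nonneg hs.1 hl1
    · exact mul_le_of_le_one_left hl1 hs.2
  -- Parametrization by arc length. `t` need be neither continuous nor monotone: by `hdist`,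
  -- parameters with the same value of `l` give the same point.
  choose! t ht hlt using hsurj
  refine ⟨fun s ↦ γ (t s), ?_, ?_, fun s hs s' hs' ↦ ?_⟩
  · have := hdist _ (ht 0 (by simp)) 0 (by simp)
    simpa [hlt 0 (by simp), hl0] using this
  · have := hdist _ (ht 1 (by simp)) 1 (by simp)
    simpa [hlt 1 (by simp)] using this
  · refine (hdist _ (ht s hs) _ (ht s' hs')).trans ?_
    have h1R : ENNReal.ofReal (l 1) ≤ R := by
      simp only [l]
      rw [ENNReal.ofReal_toReal hγR.ne_top]; exact hγR.le
    rw [hlt s hs, hlt s' hs', ← sub_mul, abs_mul, abs_of_nonneg hl1,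
      ENNReal.ofReal_mul (abs_nonneg _), mul_comm, ← Real.dist_eq, ← edist_dist]
    gcongr

end LengthSpaces

/-! ### Metric speed and norm of the velocity -/

section MetricSpeed

section Real

/-- Lipschitz functions are absolutely continuous, hence integrals of their derivative. -/
lemma LipschitzOnWith.le_of_ae_deriv_nonneg {w : ℝ → ℝ} {K : ℝ≥0} {a b : ℝ} (hab : a ≤ b)
    (hw : LipschitzOnWith K w (Icc a b)) (h : ∀ᵐ s ∂volume.restrict (Icc a b), 0 ≤ deriv w s) :
    w a ≤ w b := by
  have hac : AbsolutelyContinuousOnInterval w a b :=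
    LipschitzOnWith.absolutelyContinuousOnInterval (by rwa [uIcc_of_le hab])
  have := intervalIntegral.integral_nonneg_of_ae_restrict hab h
  rw [hac.integral_deriv_eq_sub] at this
  linarith

/-- By the weak version on subintervals, equal end values would make `w` constant, with zero
derivative on a set of positive measure. -/
lemma LipschitzOnWith.lt_of_ae_deriv_pos {w : ℝ → ℝ} {K : ℝ≥0} {a b : ℝ} (hab : a < b)
    (hw : LipschitzOnWith K w (Icc a b)) (h : ∀ᵐ s ∂volume.restrict (Icc a b), 0 < deriv w s) :
    w a < w b := by
  have hle : ∀ s ∈ Icc a b, w a ≤ w s ∧ w s ≤ w b := fun s hs ↦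
    ⟨(hw.mono (Icc_subset_Icc_right hs.2)).le_of_ae_deriv_nonneg hs.1
      (ae_restrict_of_ae_restrict_of_subset (Icc_subset_Icc_right hs.2) (h.mono fun _ h ↦ h.le)),
    (hw.mono (Icc_subset_Icc_left hs.1)).le_of_ae_deriv_nonneg hs.2
      (ae_restrict_of_ae_restrict_of_subset (Icc_subset_Icc_left hs.1) (h.mono fun _ h ↦ h.le))⟩
  refine (hle b ⟨hab.le, le_rfl⟩).1.lt_of_ne fun heq ↦ ?_
  have hconst : ∀ s ∈ Ioo a b, deriv w s = 0 := by
    intro s hs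
    have : w =ᶠ[𝓝 s] fun _ ↦ w a := by
      filter_upwards [isOpen_Ioo.mem_nhds hs] with r hr
      have := hle r (Ioo_subset_Icc_self hr)
      exact le_antisymm (this.2.trans heq.ge) this.1
    rw [this.deriv_eq, deriv_const]
  have h' := ae_restrict_of_ae_restrict_of_subset Ioo_subset_Icc_self h
  have hne : (ae (volume.restrict (Ioo a b))).NeBot := by
    rw [ae_neBot, Ne, Measure.restrict_eq_zero]
    simp [hab]
  obtain ⟨s, hs, hs'⟩ := (h'.and (ae_restrict_mem measurableSet_Ioo)).exists
  exact hs.ne' (hconst s hs')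

/-- A Lipschitz curve whose speed is almost everywhere at most the derivative of `k`. -/
lemma edist_le_of_ae_eventually_edist_le {X : Type*} [PseudoEMetricSpace X] {x : ℝ → X} {k : ℝ → ℝ}
    {K K' : ℝ≥0} {a b : ℝ} (hab : a ≤ b) (hx : LipschitzOnWith K x (Icc a b))
    (hk : LipschitzOnWith K' k (Icc a b))
    (h : ∀ᵐ s ∂volume.restrict (Icc a b), ∃ k' : ℝ, 0 ≤ k' ∧ HasDerivAt k k' s ∧
      ∀ C > k', ∀ᶠ r in 𝓝 s, edist (x s) (x r) ≤ ENNReal.ofReal (C * |r - s|)) :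
    edist (x a) (x b) ≤ ENNReal.ofReal (k b - k a) := by
  have hfin : ∀ r ∈ Icc a b, ∀ s ∈ Icc a b, edist (x r) (x s) ≠ ⊤ := fun r hr s hs ↦
    ne_top_of_le_ne_top (ENNReal.mul_ne_top ENNReal.coe_ne_top (edist_ne_top r s)) (hx hr hs)
  have ha : a ∈ Icc a b := ⟨le_rfl, hab⟩
  have hb : b ∈ Icc a b := ⟨hab, le_rfl⟩
  -- This reduces the claim to real functions: `d` inherits the speed bound of `x` by the triangle
  -- inequality, so `k - d` has nonnegative derivative almost everywhere.
  let d : ℝ → ℝ := fun r ↦ (edist (x a) (x r)).toReal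
  have hd : ∀ r ∈ Icc a b, ∀ s ∈ Icc a b, |d r - d s| ≤ (edist (x s) (x r)).toReal := by
    have key : ∀ r ∈ Icc a b, ∀ s ∈ Icc a b, d r ≤ d s + (edist (x s) (x r)).toReal := by
      intro r hr s hs
      rw [← ENNReal.toReal_add (hfin a ha s hs) (hfin s hs r hr)]
      exact ENNReal.toReal_mono (ENNReal.add_ne_top.2 ⟨hfin a ha s hs, hfin s hs r hr⟩)
        (edist_triangle _ _ _)
    intro r hr s hs
    have h1 := key r hr s hs
    have h2 := key s hs r hr
    rw [edist_comm] at h2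
    rw [abs_le]
    constructor <;> linarith
  have hdL : LipschitzOnWith K d (Icc a b) := by
    refine LipschitzOnWith.of_dist_le_mul fun r hr s hs ↦ ?_
    rw [Real.dist_eq]
    refine (hd r hr s hs).trans ?_
    rw [edist_comm]
    refine ENNReal.toReal_le_of_le_ofReal (by positivity) ((hx hr hs).trans_eq ?_)
    rw [ENNReal.ofReal_mul (by positivity), ← edist_dist, ENNReal.ofReal_coe_nnreal]
  have hac : AbsolutelyContinuousOnInterval d a b :=
    LipschitzOnWith.absolutelyContinuousOnInterval (by rwa [uIcc_of_le hab])
  have hdd := hac.ae_differentiableAt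
  have hw : LipschitzOnWith (K' + K) (fun r ↦ k r - d r) (Icc a b) := hk.sub hdL
  have hle := hw.le_of_ae_deriv_nonneg hab (by
    have h' : ∀ᵐ s ∂volume.restrict (Icc a b), s ∈ Ioo a b := by
      rw [← restrict_Ioo_eq_restrict_Icc]
      exact ae_restrict_mem measurableSet_Ioo
    filter_upwards [h, ae_restrict_of_ae hdd, h'] with s hs hds hs'
    obtain ⟨k', hk0, hk', hC⟩ := hs
    have hds := (hds (by rw [uIcc_of_le hab]; exact Ioo_subset_Icc_self hs')).hasDerivAt
    rw [(hk'.fun_sub hds).deriv]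
    have : ‖deriv d s‖ ≤ k' := by
      refine le_of_forall_gt_imp_ge_of_dense fun C hCk ↦ ?_
      have hC0 : 0 ≤ C := hk0.trans hCk.le
      refine hds.le_of_lip' hC0 ?_
      filter_upwards [hC C hCk, isOpen_Ioo.mem_nhds hs'] with r hr hr'
      refine (hd r (Ioo_subset_Icc_self hr') s (Ioo_subset_Icc_self hs')).trans ?_
      exact ENNReal.toReal_le_of_le_ofReal (by positivity) hr
    have := (le_abs_self _).trans this
    linarith)
  have hda : d a = 0 := by simp [d]
  rw [← ENNReal.ofReal_toReal (hfin a ha b hb)]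
  refine ENNReal.ofReal_le_ofReal ?_
  change d b ≤ _
  linarith

/-- A transitive relation that holds locally on an interval holds on the interval. -/
lemma rel_of_locally_rel {J : Set ℝ} (hJ : J.OrdConnected) {R : ℝ → ℝ → Prop}
    (hR : ∀ a b c, R a b → R b c → R a c) (hrefl : ∀ a, R a a)
    (h : ∀ s ∈ J, ∃ u ∈ 𝓝[J] s, ∀ a ∈ u, ∀ b ∈ u, a ≤ b → R a b) {a b : ℝ} (ha : a ∈ J) (hb : b ∈ J)
    (hab : a ≤ b) : R a b := by
  have hsub := hJ.out ha hb
  choose u hu hRu using fun s : Icc a b ↦ h s (hsub s.2)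
  choose v hv hsv hvu using fun s : Icc a b ↦ mem_nhdsWithin.1 (hu s)
  -- By compactness, `[a, b]` has a finite subdivision each of whose intervals lies in one of the
  -- given neighbourhoods.
  obtain ⟨t, ht0, htm, ⟨m, hm⟩, ht⟩ := exists_monotone_Icc_subset_open_cover_Icc hab
    (c := fun s ↦ ((↑) : Icc a b → ℝ) ⁻¹' v s) (fun s ↦ (hv s).preimage continuous_subtype_val)
    (fun s _ ↦ mem_iUnion.2 ⟨s, hsv s⟩)
  have key : ∀ k, R a (t k) := by
    intro k
    induction k with
    | zero => rw [ht0]; exact hrefl a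
    | succ k ih =>
      obtain ⟨s, hs⟩ := ht k
      refine hR _ _ _ ih (hRu s _ (hvu s ⟨?_, hsub (t k).2⟩) _ (hvu s ⟨?_, hsub (t (k + 1)).2⟩)
        (htm k.le_succ))
      · exact hs ⟨le_rfl, htm k.le_succ⟩
      · exact hs ⟨htm k.le_succ, le_rfl⟩
  have := key m
  rwa [hm m le_rfl] at this

end Real

variable {n : ℕ} {S : Type*} [EMetricSpace S] [ChartedSpace (EuclideanSpace ℝ (Fin n)) S]
    [IsManifold (𝓡 n) ∞ S]
    [RiemannianBundle (fun x : S ↦ TangentSpace (𝓡 n) x)]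
    [IsContinuousRiemannianBundle (EuclideanSpace ℝ (Fin n))
      (fun x : S ↦ TangentSpace (𝓡 n) x)]
    [IsRiemannianManifold (𝓡 n) S]

/-- At the centre of the chart the two trivialization maps cancel, so no distortion remains. -/
lemma hasDerivAt_tangentChart_comp {x : ℝ → S} {s : ℝ}
    (hx : MDifferentiableAt 𝓘(ℝ, ℝ) (𝓡 n) x s) :
    HasDerivAt (fun r ↦ tangentChart n (x s) (x r)) (mfderiv 𝓘(ℝ, ℝ) (𝓡 n) x s (1 : ℝ)) s := by
  have h1 := hasDerivWithinAt_tangentChart_comp (mdifferentiableWithinAt_univ.2 hx)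
    (mem_chart_source (EuclideanSpace ℝ (Fin n)) (x s))
  rw [Trivialization.symmL_continuousLinearMapAt (R := ℝ)
    (trivializationAt (EuclideanSpace ℝ (Fin n)) (TangentSpace (𝓡 n)) (x s))
    (mem_chart_source _ (x s)), mfderivWithin_univ] at h1
  exact h1.hasDerivAt univ_mem

/-- The metric speed of a differentiable curve is at most the norm of its velocity. -/
lemma eventually_edist_le_of_norm_mfderiv_lt {x : ℝ → S} {s : ℝ}
    (hx : MDifferentiableAt 𝓘(ℝ, ℝ) (𝓡 n) x s) {C : ℝ}
    (hC : ‖mfderiv 𝓘(ℝ, ℝ) (𝓡 n) x s (1 : ℝ)‖ < C) :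
    ∀ᶠ r in 𝓝 s, edist (x s) (x r) ≤ ENNReal.ofReal (C * |r - s|) := by
  -- The gap between `C'` and `C` leaves a factor `C / C' > 1` for the distortion of the chart.
  obtain ⟨C', h1, h2⟩ := exists_between hC
  have hC'0 : 0 < C' := (norm_nonneg _).trans_lt h1
  lift C' to ℝ≥0 using hC'0.le
  lift C to ℝ≥0 using (hC'0.trans h2).le
  have hr : 1 < C / C' := by
    rw [one_lt_div (by exact_mod_cast hC'0)]
    exact_mod_cast h2
  have h3 := (hasDerivAt_tangentChart_comp hx).hasDerivWithinAt (s := univ).limsup_norm_slope_le h1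
  rw [nhdsWithin_univ] at h3
  have h4 : Tendsto (fun r ↦ (x s, x r)) (𝓝 s) (𝓝 (x s, x s)) :=
    tendsto_const_nhds.prodMk_nhds hx.continuousAt
  filter_upwards [h3, h4.eventually (eventually_edist_le_edist_tangentChart (n := n) (x s) hr)]
    with r h5 h6
  have h7 : edist (tangentChart n (x s) (x s)) (tangentChart n (x s) (x r)) ≤
      ENNReal.ofReal (C' * |r - s|) := by
    rw [edist_comm, edist_dist, dist_eq_norm]
    refine ENNReal.ofReal_le_ofReal ?_
    rcases eq_or_ne r s with rfl | hrs
    · simp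
    · have h8 : 0 < ‖r - s‖ := norm_pos_iff.2 (sub_ne_zero.2 hrs)
      rw [inv_mul_lt_iff₀ h8] at h5
      rw [mul_comm]
      exact h5.le
  refine h6.trans ((mul_le_mul_right h7 _).trans_eq ?_)
  rw [← ENNReal.ofReal_coe_nnreal, ← ENNReal.ofReal_mul (by positivity), ← mul_assoc,
    NNReal.coe_div, div_mul_cancel₀ _ hC'0.ne']

/-- The norm of the velocity of a differentiable curve is at most its metric speed. -/
lemma norm_mfderiv_le_of_eventually_edist_le {x : ℝ → S} {s : ℝ}
    (hx : MDifferentiableAt 𝓘(ℝ, ℝ) (𝓡 n) x s) {C : ℝ} (hC0 : 0 ≤ C)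
    (hC : ∀ᶠ r in 𝓝 s, edist (x s) (x r) ≤ ENNReal.ofReal (C * |r - s|)) :
    ‖mfderiv 𝓘(ℝ, ℝ) (𝓡 n) x s (1 : ℝ)‖ ≤ C := by
  lift C to ℝ≥0 using hC0
  have key : ∀ q : ℝ≥0, 1 < q → ‖mfderiv 𝓘(ℝ, ℝ) (𝓡 n) x s (1 : ℝ)‖ ≤ q * C := by
    intro q hq
    refine (hasDerivAt_tangentChart_comp hx).le_of_lip' (by positivity) ?_
    have h4 : Tendsto (fun r ↦ (x s, x r)) (𝓝 s) (𝓝 (x s, x s)) :=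
      tendsto_const_nhds.prodMk_nhds hx.continuousAt
    filter_upwards [hC, h4.eventually (eventually_edist_tangentChart_le (n := n) (x s) hq)]
      with r h5 h6
    rw [← dist_eq_norm, dist_comm, dist_edist]
    refine ENNReal.toReal_le_of_le_ofReal (by positivity) (h6.trans ?_)
    rw [mul_assoc, ENNReal.ofReal_mul (by positivity), ENNReal.ofReal_coe_nnreal]
    gcongr
    exact h5
  have hlim : Tendsto (fun q : ℝ≥0 ↦ (q : ℝ) * C) (𝓝[>] 1) (𝓝 (1 * C)) :=
    ((NNReal.continuous_coe.tendsto 1).mono_left nhdsWithin_le_nhds).mul_const _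
  rw [one_mul] at hlim
  exact ge_of_tendsto hlim (eventually_mem_nhdsWithin.mono key)

/-- Charts are bi-Lipschitz near their centre. This and the next lemma translate between the chart
condition in `IsCausalCurve` and the distance of `S`. -/
lemma exists_lipschitzOnWith_of_lipschitzOnWith_extChartAt {x : ℝ → S} {p : S} {K : ℝ≥0}
    {u : Set ℝ} (h : LipschitzOnWith K (fun r ↦ extChartAt (𝓡 n) p (x r)) u) :
    ∃ K' : ℝ≥0, ∃ U ∈ 𝓝 p, LipschitzOnWith K' x (u ∩ x ⁻¹' U) := by
  have h1 := eventually_edist_le_edist_tangentChart (n := n) p one_lt_two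
  rw [nhds_prod_eq] at h1
  obtain ⟨U, hU, hU'⟩ := mem_prod_same_iff.1 h1
  let L := (trivializationAt (EuclideanSpace ℝ (Fin n)) (TangentSpace (𝓡 n)) p).symmL ℝ p
  refine ⟨2 * (‖L‖₊ * K), U, hU, fun r hr r' hr' ↦ ?_⟩
  refine (@hU' (x r, x r') ⟨hr.2, hr'.2⟩).trans ?_
  rw [ENNReal.coe_mul, mul_assoc]
  gcongr
  exact (L.lipschitz.comp_lipschitzOnWith h) hr.1 hr'.1

lemma exists_lipschitzOnWith_extChartAt {x : ℝ → S} {p : S} {K : ℝ≥0}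
    {u : Set ℝ} (h : LipschitzOnWith K x u) :
    ∃ K' : ℝ≥0, ∃ U ∈ 𝓝 p,
      LipschitzOnWith K' (fun r ↦ extChartAt (𝓡 n) p (x r)) (u ∩ x ⁻¹' U) := by
  have h1 := eventually_edist_tangentChart_le (n := n) p one_lt_two
  rw [nhds_prod_eq] at h1
  obtain ⟨U, hU, hU'⟩ := mem_prod_same_iff.1 h1
  let L := (trivializationAt (EuclideanSpace ℝ (Fin n)) (TangentSpace (𝓡 n)) p).continuousLinearMapAt
    ℝ p
  have hL : ∀ v, L (tangentChart n p v) = extChartAt (𝓡 n) p v := fun v ↦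
    Trivialization.continuousLinearMapAt_symmL (R := ℝ)
      (trivializationAt (EuclideanSpace ℝ (Fin n)) (TangentSpace (𝓡 n)) p) (mem_chart_source _ p) _
  refine ⟨‖L‖₊ * (2 * K), U, hU, fun r hr r' hr' ↦ ?_⟩
  simp only [← hL]
  refine (L.lipschitz _ _).trans ?_
  rw [ENNReal.coe_mul, mul_assoc]
  gcongr
  refine (@hU' (x r, x r') ⟨hr.2, hr'.2⟩).trans ?_
  rw [ENNReal.coe_mul, mul_assoc]
  gcongr
  exact h hr.1 hr'.1

end MetricSpeed

/-! ### Causal curves of a warped metric -/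

section CausalCurves

variable {n : ℕ} {S : Type*} [EMetricSpace S] [ChartedSpace (EuclideanSpace ℝ (Fin n)) S]

section

variable [IsManifold (𝓡 n) ∞ S]

lemma mdifferentiableAt_coe_snd (p : S × PosHalfLine) :
    MDifferentiableAt (prodModel n) 𝓘(ℝ, ℝ) (fun q : S × PosHalfLine ↦ (q.2 : ℝ)) p :=
  ((contMDiff_subtype_val (n := 1)).comp contMDiff_snd).mdifferentiable one_ne_zero p

lemma hasDerivAt_coe_snd {γ : ℝ → S × PosHalfLine} {s : ℝ}
    (hγ : MDifferentiableAt 𝓘(ℝ, ℝ) (prodModel n) γ s) :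
    HasDerivAt (fun r ↦ ((γ r).2 : ℝ))
      (dTime (γ s) (mfderiv 𝓘(ℝ, ℝ) (prodModel n) γ s (1 : ℝ))) s := by
  have h1 := (mdifferentiableAt_coe_snd (n := n) (γ s)).hasMFDerivAt.comp s hγ.hasMFDerivAt
  let D : ℝ →L[ℝ] ℝ := (dTime (n := n) (γ s)).comp (mfderiv 𝓘(ℝ, ℝ) (prodModel n) γ s)
  have h2 : HasFDerivAt (fun r ↦ ((γ r).2 : ℝ)) D s := hasMFDerivAt_iff_hasFDerivAt.1 h1
  exact h2.hasDerivAt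

lemma mdifferentiableAt_fst_comp {γ : ℝ → S × PosHalfLine} {s : ℝ}
    (hγ : MDifferentiableAt 𝓘(ℝ, ℝ) (prodModel n) γ s) :
    MDifferentiableAt 𝓘(ℝ, ℝ) (𝓡 n) (fun r ↦ (γ r).1) s :=
  MDifferentiableAt.comp s (mdifferentiableAt_fst (I := 𝓡 n) (I' := 𝓘(ℝ, ℝ))) hγ

lemma mfderiv_fst_comp {γ : ℝ → S × PosHalfLine} {s : ℝ}
    (hγ : MDifferentiableAt 𝓘(ℝ, ℝ) (prodModel n) γ s) :
    mfderiv 𝓘(ℝ, ℝ) (𝓡 n) (fun r ↦ (γ r).1) s (1 : ℝ) =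
      dSpace (γ s) (mfderiv 𝓘(ℝ, ℝ) (prodModel n) γ s (1 : ℝ)) :=
  congr($(mfderiv_comp s (mdifferentiableAt_fst (I := 𝓡 n) (I' := 𝓘(ℝ, ℝ))) hγ) (1 : ℝ))

lemma extChartAt_prodModel (p q : S × PosHalfLine) :
    extChartAt (prodModel n) p q = (extChartAt (𝓡 n) p.1 q.1, (q.2 : ℝ)) := by
  rw [extChartAt_prod]
  rfl

end

variable [IsManifold (𝓡 n) ∞ S] [RiemannianBundle (fun x : S ↦ TangentSpace (𝓡 n) x)]
    [IsContMDiffRiemannianBundle (𝓡 n) ∞ (EuclideanSpace ℝ (Fin n))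
      (fun x : S ↦ TangentSpace (𝓡 n) x)]

instance : IsContinuousRiemannianBundle (EuclideanSpace ℝ (Fin n))
    (fun x : S ↦ TangentSpace (𝓡 n) x) :=
  IsContMDiffRiemannianBundle.isContinuousRiemannianBundle (𝓡 n) ∞

section

variable {c : ℝ} {hc : 0 < c} {f : ℝ → ℝ} {hf : ∀ t, 0 < t → 0 < f t}
  {hf' : ContDiffOn ℝ ∞ f (Ioi 0)}

/-- Pairing with `∂/∂t` gives `-c dt(v)`, so future directed means `dt(v) > 0`; the causal
inequality `f |dx(v)|² ≤ c dt(v)²` is then the square of the stated one. -/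
lemma isFutureCausal_warpedMetric_iff {p : S × PosHalfLine} {v : TangentSpace (prodModel n) p} :
    (warpedMetric S c hc f hf hf').IsFutureCausal p v ↔
      0 < dTime p v ∧ ‖dSpace p v‖ ≤ √(c / f p.2) * dTime p v := by
  have hfp : 0 < f p.2 := hf p.2 p.2.2
  have h1 : (warpedMetric S c hc f hf hf').form p v v =
      -c * (dTime p v * dTime p v) + f p.2 * (‖dSpace p v‖ * ‖dSpace p v‖) := by
    rw [← real_inner_self_eq_norm_mul_norm]
    rfl
  have h2 : (warpedMetric S c hc f hf hf').form p ((warpedMetric S c hc f hf hf').T p) v =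
      -c * dTime p v := by
    change warpedForm S c f p (timeField p) v = _
    rw [warpedForm_apply, dTime_timeField, dSpace_timeField, inner_zero_left]
    ring
  rw [TimeOrientedLorentzMetric.IsFutureCausal, h1, h2]
  have h3 : -c * dTime p v < 0 ↔ 0 < dTime p v := by
    rw [neg_mul, neg_lt_zero, mul_pos_iff_of_pos_left hc]
  rw [h3]
  have h4 : 0 < dTime p v →
      (-c * (dTime p v * dTime p v) + f p.2 * (‖dSpace p v‖ * ‖dSpace p v‖) ≤ 0 ↔
        ‖dSpace p v‖ ≤ √(c / f p.2) * dTime p v) := by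
    intro ht
    rw [← sq_le_sq₀ (norm_nonneg _) (by positivity), mul_pow, Real.sq_sqrt (by positivity),
      div_mul_eq_mul_div, le_div_iff₀ hfp]
    constructor <;> intro h <;> nlinarith
  constructor
  · rintro ⟨-, h5, h6⟩
    exact ⟨h6, (h4 h6).1 h5⟩
  · rintro ⟨h6, h5⟩
    refine ⟨?_, (h4 h6).2 h5, h6⟩
    rintro rfl
    simp at h6

variable [IsRiemannianManifold (𝓡 n) S] {Φ : ℝ → ℝ}

lemma strictMonoOn_of_hasStrictDerivAt_sqrt (hc : 0 < c) (hf : ∀ t, 0 < t → 0 < f t)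
    (hΦ : ∀ t, 0 < t → HasStrictDerivAt Φ (√(c / f t)) t) : StrictMonoOn Φ (Ioi 0) := by
  refine strictMonoOn_of_deriv_pos (convex_Ioi 0)
    (fun t ht ↦ (hΦ t ht).hasDerivAt.continuousAt.continuousWithinAt) ?_
  rw [interior_Ioi]
  intro t ht
  rw [(hΦ t ht).hasDerivAt.deriv]
  exact Real.sqrt_pos.2 (div_pos hc (hf t ht))

/-- Along a causal curve, `t` increases, and the distance travelled in `S` is at most the increase
of `Φ ∘ t`, where `Φ' = √(c / f)`. -/
theorem lt_and_edist_le_of_isCausalCurve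
    (hΦ : ∀ t, 0 < t → HasStrictDerivAt Φ (√(c / f t)) t)
    {γ : ℝ → S × PosHalfLine} {J : Set ℝ}
    (hγ : (warpedMetric (n := n) S c hc f hf hf').IsCausalCurve γ J) {a b : ℝ} (ha : a ∈ J) (hb : b ∈ J)
    (hab : a < b) :
    ((γ a).2 : ℝ) < (γ b).2 ∧
      edist (γ a).1 (γ b).1 ≤ ENNReal.ofReal (Φ (γ b).2 - Φ (γ a).2) := by
  have hmono := (strictMonoOn_of_hasStrictDerivAt_sqrt hc hf hΦ).monotoneOn
  -- Equality is included because `rel_of_locally_rel` needs a reflexive relation; `a < b` discards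
  -- it.
  let R : ℝ → ℝ → Prop := fun a b ↦ a = b ∨ (((γ a).2 : ℝ) < (γ b).2 ∧
      edist (γ a).1 (γ b).1 ≤ ENNReal.ofReal (Φ (γ b).2 - Φ (γ a).2))
  suffices R a b from this.resolve_left hab.ne
  refine rel_of_locally_rel hγ.ordConnected (R := R) ?_ (fun a ↦ Or.inl rfl) ?_ ha hb hab.le
  · rintro a b d (rfl | ⟨h1, h2⟩) h
    · exact h
    · rcases h with rfl | ⟨h3, h4⟩
      · exact Or.inr ⟨h1, h2⟩
      · refine Or.inr ⟨h1.trans h3, (edist_triangle _ _ _).trans ((add_le_add h2 h4).trans_eq ?_)⟩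
        have h5 := hmono (γ a).2.2 (γ b).2.2 h1.le
        have h6 := hmono (γ b).2.2 (γ d).2.2 h3.le
        rw [← ENNReal.ofReal_add (by linarith) (by linarith)]
        congr 1
        ring
  · intro s hs
    obtain ⟨K, u, hu, hK⟩ := hγ.locallyLipschitz s hs
    simp only [extChartAt_prodModel] at hK
    have hx := LipschitzWith.prod_fst.comp_lipschitzOnWith hK
    have ht : LipschitzOnWith (1 * K) (fun r ↦ ((γ r).2 : ℝ)) u :=
      LipschitzWith.prod_snd.comp_lipschitzOnWith hK
    obtain ⟨K', U, hU, hxU⟩ := exists_lipschitzOnWith_of_lipschitzOnWith_extChartAt hx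
    -- Strict differentiability makes `Φ` locally Lipschitz, and so also `Φ ∘ t`.
    obtain ⟨K'', V, hV, hΦV⟩ := (hΦ _ (γ s).2.2).hasStrictFDerivAt.exists_lipschitzOnWith
    have hc1 : ContinuousWithinAt (fun r ↦ (γ r).1) J s := (hγ.continuousOn s hs).fst
    have hc2 : ContinuousWithinAt (fun r ↦ ((γ r).2 : ℝ)) J s :=
      continuous_subtype_val.continuousAt.comp_continuousWithinAt (hγ.continuousOn s hs).snd
    have hmem := inter_mem (inter_mem hu self_mem_nhdsWithin) (inter_mem (hc1 hU) (hc2 hV))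
    obtain ⟨ε, ε0, hε⟩ := Metric.mem_nhdsWithin_iff.1 hmem
    refine ⟨Metric.ball s ε ∩ J, inter_mem (mem_nhdsWithin_of_mem_nhds (Metric.ball_mem_nhds s ε0))
      self_mem_nhdsWithin, fun a ha b hb hab ↦ ?_⟩
    rcases hab.eq_or_lt with rfl | hab
    · exact Or.inl rfl
    right
    have hord : (Metric.ball s ε ∩ J).OrdConnected := by
      rw [Real.ball_eq_Ioo]
      exact ordConnected_Ioo.inter hγ.ordConnected
    have hsub := (hord.out ha hb).trans hε
    have hae := ae_restrict_of_ae_restrict_of_subset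
      ((hord.out ha hb).trans inter_subset_right) hγ.ae_futureCausal
    constructor
    · refine LipschitzOnWith.lt_of_ae_deriv_pos hab (ht.mono fun r hr ↦ (hsub hr).1.1) ?_
      filter_upwards [hae] with r hr
      rw [(hasDerivAt_coe_snd hr.1).deriv]
      exact (isFutureCausal_warpedMetric_iff.1 hr.2).1
    · refine edist_le_of_ae_eventually_edist_le (k := fun r ↦ Φ (γ r).2) hab.le
        (hxU.mono fun r hr ↦ ⟨(hsub hr).1.1, (hsub hr).2.1⟩)
        (hΦV.comp (ht.mono fun r hr ↦ (hsub hr).1.1) fun r hr ↦ (hsub hr).2.2) ?_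
      filter_upwards [hae] with r hr
      obtain ⟨h1, h2⟩ := isFutureCausal_warpedMetric_iff.1 hr.2
      -- The chain rule gives `(Φ ∘ t)' = √(c / f) dt(γ')`, exactly the bound on `|dx(γ')|` from
      -- causality.
      refine ⟨_, by positivity,
        (hΦ _ (γ r).2.2).hasDerivAt.comp r (hasDerivAt_coe_snd hr.1), fun C hC ↦ ?_⟩
      refine eventually_edist_le_of_norm_mfderiv_lt (mdifferentiableAt_fst_comp hr.1) ?_
      rw [mfderiv_fst_comp hr.1]
      exact h2.trans_lt hC

/-- A curve parametrized by `t`, whose increments in `S` are bounded by those of `Φ`, is causal. -/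
theorem isCausalCurve_of_edist_le
    (hΦ : ∀ t, 0 < t → HasStrictDerivAt Φ (√(c / f t)) t)
    {z : ℝ → S} {a b : ℝ} (ha : 0 < a) (hab : a < b)
    (hz : ∀ s ∈ Icc a b, ∀ r ∈ Icc a b, edist (z s) (z r) ≤ ENNReal.ofReal |Φ s - Φ r|) :
    (warpedMetric (n := n) S c hc f hf hf').IsCausalCurve
      (fun s ↦ ((z s, ⟨max s a, ha.trans_le (le_max_right s a)⟩) : S × PosHalfLine)) (Icc a b) := by
  have hloc : ∀ s ∈ Icc a b, ∃ K : ℝ≥0, ∃ u ∈ 𝓝 s, LipschitzOnWith K z (u ∩ Icc a b) := by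
    intro s hs
    obtain ⟨K, u, hu, hK⟩ := (hΦ s (ha.trans_le hs.1)).hasStrictFDerivAt.exists_lipschitzOnWith
    refine ⟨K, u, hu, fun r hr r' hr' ↦ (hz r hr.2 r' hr'.2).trans ?_⟩
    rw [← Real.dist_eq, ← edist_dist]
    exact hK hr.1 hr'.1
  have hzc : ContinuousOn z (Icc a b) := by
    intro s hs
    obtain ⟨K, u, hu, hK⟩ := hloc s hs
    refine (hK.continuousOn s ⟨mem_of_mem_nhds hu, hs⟩).mono_of_mem_nhdsWithin ?_
    exact inter_mem (mem_nhdsWithin_of_mem_nhds hu) self_mem_nhdsWithin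
  have hlip : ∀ s ∈ Icc a b, ∃ K : ℝ≥0, ∃ u ∈ 𝓝[Icc a b] s, u ⊆ Icc a b ∧
      LipschitzOnWith K (fun r ↦ extChartAt (𝓡 n) (z s) (z r)) u := by
    intro s hs
    obtain ⟨K, u, hu, hK⟩ := hloc s hs
    obtain ⟨K', U, hU, hK'⟩ := exists_lipschitzOnWith_extChartAt (n := n) (p := z s) hK
    exact ⟨K', _, inter_mem (inter_mem (mem_nhdsWithin_of_mem_nhds hu) self_mem_nhdsWithin)
      (hzc s hs hU), fun r hr ↦ hr.1.2, hK'⟩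
  refine ⟨ordConnected_Icc, ⟨a, ⟨le_rfl, hab.le⟩, b, ⟨hab.le, le_rfl⟩, hab.ne⟩, ?_, ?_, ?_⟩
  · refine hzc.prodMk (Continuous.continuousOn ?_)
    -- `max s a` equals `s` on `[a, b]`; it only keeps the time coordinate positive for every real
    -- `s`.
    exact Continuous.subtype_mk (by fun_prop) _
  · intro s hs
    obtain ⟨K, u, hu, -, hK⟩ := hlip s hs
    refine ⟨max K 1, u, hu, ?_⟩
    simp only [extChartAt_prodModel]
    exact hK.prodMk ((LipschitzWith.id.max_const a).lipschitzOnWith)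
  · have hdiff : ∀ᵐ s ∂volume.restrict (Ioo a b), MDifferentiableAt 𝓘(ℝ, ℝ) (𝓡 n) z s := by
      rw [ae_restrict_iff' measurableSet_Ioo, ae_iff]
      refine measure_null_of_locally_null _ fun s₀ hs₀ ↦ ?_
      simp only [mem_ofPred_eq, Classical.not_imp] at hs₀
      have hs₀' := Icc_mem_nhds hs₀.1.1 hs₀.1.2
      obtain ⟨K, u, hu, huI, hK⟩ := hlip s₀ (Ioo_subset_Icc_self hs₀.1)
      rw [nhdsWithin_eq_nhds.2 hs₀'] at hu
      have hsrc := (hzc.continuousAt hs₀').preimage_mem_nhds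
        (extChartAt_source_mem_nhds (I := 𝓡 n) (z s₀))
      have hmem := interior_mem_nhds.2 (inter_mem hu hsrc)
      refine ⟨_, inter_mem self_mem_nhdsWithin (mem_nhdsWithin_of_mem_nhds hmem), ?_⟩
      have hae := hK.ae_differentiableWithinAt_of_mem (μ := volume)
      rw [ae_iff] at hae
      refine measure_mono_null ?_ hae
      rintro r ⟨hr1, hr2⟩ hr
      simp only [mem_ofPred_eq, Classical.not_imp] at hr1
      refine hr1.2 ?_
      have hr3 := isOpen_interior.mem_nhds hr2
      have hd : DifferentiableAt ℝ (fun r ↦ extChartAt (𝓡 n) (z s₀) (z r)) r :=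
        (hr (interior_subset hr2).1).differentiableAt
          (mem_of_superset hr3 (interior_subset.trans inter_subset_left))
      have hinv : MDifferentiableAt 𝓘(ℝ, EuclideanSpace ℝ (Fin n)) (𝓡 n)
          (extChartAt (𝓡 n) (z s₀)).symm (extChartAt (𝓡 n) (z s₀) (z r)) :=
        ((contMDiffOn_extChartAt_symm (n := 1) (z s₀)).contMDiffAt
          (extChartAt_target_mem_nhds' ((extChartAt (𝓡 n) (z s₀)).map_source
            (interior_subset hr2).2))).mdifferentiableAt one_ne_zero
      refine (MDifferentiableAt.comp r hinv hd.mdifferentiableAt).congr_of_eventuallyEq ?_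
      filter_upwards [hr3] with r' hr'
      exact ((extChartAt (𝓡 n) (z s₀)).left_inv (interior_subset hr').2).symm
    rw [← restrict_Ioo_eq_restrict_Icc]
    filter_upwards [hdiff, ae_restrict_mem measurableSet_Ioo] with s hzs hs
    have hγ : MDifferentiableAt 𝓘(ℝ, ℝ) (prodModel n)
        (fun s ↦ ((z s, ⟨max s a, ha.trans_le (le_max_right s a)⟩) : S × PosHalfLine)) s := by
      refine hzs.prodMk ?_
      have hs0 : 0 < s := ha.trans hs.1
      let p : PosHalfLine := ⟨s, hs0⟩
      have hinv : MDifferentiableAt 𝓘(ℝ, ℝ) 𝓘(ℝ, ℝ) (extChartAt 𝓘(ℝ, ℝ) p).symm s :=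
        ((contMDiffOn_extChartAt_symm (n := 1) p).contMDiffAt
          (extChartAt_target_mem_nhds p)).mdifferentiableAt one_ne_zero
      refine hinv.congr_of_eventuallyEq ?_
      filter_upwards [isOpen_Ioi.mem_nhds hs.1] with r hr
      refine Subtype.ext ?_
      dsimp only
      rw [max_eq_left hr.le]
      exact (posHalfLine_chartAt_symm p r (ha.trans hr)).symm
    refine ⟨hγ, isFutureCausal_warpedMetric_iff.2 ?_⟩
    have h1 := hasDerivAt_coe_snd hγ
    have h2 : HasDerivAt (fun r : ℝ ↦ max r a) 1 s := by
      refine (hasDerivAt_id s).congr_of_eventuallyEq ?_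
      filter_upwards [isOpen_Ioi.mem_nhds hs.1] with r hr
      exact max_eq_left hr.le
    have h3 := h1.unique h2
    rw [← mfderiv_fst_comp hγ, h3]
    refine ⟨one_pos, ?_⟩
    suffices h : ‖mfderiv 𝓘(ℝ, ℝ) (𝓡 n) z s (1 : ℝ)‖ ≤ √(c / f s) by
      rw [mul_one]
      refine h.trans_eq ?_
      change √(c / f s) = √(c / f (max s a))
      rw [max_eq_left hs.1.le]
    refine le_of_forall_gt_imp_ge_of_dense fun C hC ↦ ?_
    refine norm_mfderiv_le_of_eventually_edist_le hzs ((Real.sqrt_nonneg _).trans hC.le) ?_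
    have h4 := (hΦ s (ha.trans hs.1)).hasDerivAt.hasDerivWithinAt (s := univ).limsup_norm_slope_le
      (by rwa [Real.norm_of_nonneg (Real.sqrt_nonneg _)])
    rw [nhdsWithin_univ] at h4
    filter_upwards [h4, Icc_mem_nhds hs.1 hs.2] with r hr hr'
    refine (hz s (Ioo_subset_Icc_self hs) r hr').trans (ENNReal.ofReal_le_ofReal ?_)
    rw [abs_sub_comm]
    rcases eq_or_ne r s with rfl | hrs
    · simp
    · rw [inv_mul_lt_iff₀ (norm_pos_iff.2 (sub_ne_zero.2 hrs)), mul_comm] at hr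
      exact hr.le

end

end CausalCurves

/-! ### Causal relation, global hyperbolicity and Cauchy slices -/

section WarpedProduct

variable {n : ℕ} {S : Type*} [EMetricSpace S] [ChartedSpace (EuclideanSpace ℝ (Fin n)) S]
    [IsManifold (𝓡 n) ∞ S] [RiemannianBundle (fun x : S ↦ TangentSpace (𝓡 n) x)]
    [IsContMDiffRiemannianBundle (𝓡 n) ∞ (EuclideanSpace ℝ (Fin n))
      (fun x : S ↦ TangentSpace (𝓡 n) x)] [IsRiemannianManifold (𝓡 n) S]
    {c : ℝ} {hc : 0 < c} {f : ℝ → ℝ} {hf : ∀ t, 0 < t → 0 < f t}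
    {hf' : ContDiffOn ℝ ∞ f (Ioi 0)} {Φ : ℝ → ℝ}

lemma exists_hasStrictDerivAt_sqrt (hf : ∀ t, 0 < t → 0 < f t) (hf' : ContDiffOn ℝ ∞ f (Ioi 0)) :
    ∃ Φ : ℝ → ℝ, ∀ t, 0 < t → HasStrictDerivAt Φ (√(c / f t)) t := by
  have hcont : ContinuousOn (fun t ↦ √(c / f t)) (Ioi 0) :=
    (continuousOn_const.div hf'.continuousOn fun t ht ↦ (hf t ht).ne').sqrt
  refine ⟨fun t ↦ ∫ s in (1 : ℝ)..t, √(c / f s), fun t ht ↦ ?_⟩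
  refine intervalIntegral.integral_hasStrictDerivAt_right ?_ ?_
    (hcont.continuousAt (isOpen_Ioi.mem_nhds ht))
  · refine (hcont.mono fun s hs ↦ ?_).intervalIntegrable
    exact (lt_min one_pos ht).trans_le hs.1
  · exact hcont.stronglyMeasurableAtFilter isOpen_Ioi t ht

/-- Causal futures in `S × ℝ₊` in terms of the distance of `S`. -/
theorem causalRel_warpedMetric_iff [CompleteSpace S]
    (hΦ : ∀ t, 0 < t → HasStrictDerivAt Φ (√(c / f t)) t) {p q : S × PosHalfLine} :
    (warpedMetric (n := n) S c hc f hf hf').CausalRel p q ↔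
      (p.2 : ℝ) ≤ q.2 ∧ edist p.1 q.1 ≤ ENNReal.ofReal (Φ q.2 - Φ p.2) := by
  constructor
  · rintro (rfl | ⟨γ, a, b, hab, hγ, rfl, rfl⟩)
    · simp
    · have := lt_and_edist_le_of_isCausalCurve hΦ hγ ⟨le_rfl, hab.le⟩ ⟨hab.le, le_rfl⟩ hab
      exact ⟨this.1.le, this.2⟩
  · rintro ⟨h1, h2⟩
    rcases h1.eq_or_lt with h1 | h1
    · left
      rw [h1, sub_self, ENNReal.ofReal_zero, nonpos_iff_eq_zero, edist_eq_zero] at h2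
      exact Prod.ext h2 (Subtype.ext h1)
    right
    have hmono := strictMonoOn_of_hasStrictDerivAt_sqrt hc hf hΦ
    have hL := sub_pos.2 (hmono p.2.2 q.2.2 h1)
    have : LocallyCompactSpace S := ChartedSpace.locallyCompactSpace (EuclideanSpace ℝ (Fin n)) S
    obtain ⟨ζ, h0, h1', hζ⟩ :=
      (isLengthSpace_of_isRiemannianManifold n S).exists_lipschitzOnWith h2
    -- Running along the geodesic in proportion to `Φ` turns its Lipschitz constant `Φ q.2 - Φ p.2`
    -- into the bound `|Φ s - Φ r|`.
    let ρ : ℝ → ℝ := fun s ↦ (Φ s - Φ p.2) / (Φ q.2 - Φ p.2)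
    have hρ : ∀ s ∈ Icc (p.2 : ℝ) q.2, ρ s ∈ Icc (0 : ℝ) 1 := by
      intro s hs
      have hs0 : s ∈ Ioi (0 : ℝ) := p.2.2.trans_le hs.1
      have h3 := hmono.monotoneOn p.2.2 hs0 hs.1
      have h4 := hmono.monotoneOn hs0 q.2.2 hs.2
      exact ⟨div_nonneg (by linarith) hL.le, (div_le_one hL).2 (by linarith)⟩
    refine ⟨_, p.2, q.2, h1, isCausalCurve_of_edist_le hΦ (z := fun s ↦ ζ (ρ s)) p.2.2 h1 ?_, ?_, ?_⟩
    · intro s hs r hr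
      refine (hζ (hρ s hs) (hρ r hr)).trans_eq ?_
      change ENNReal.ofReal (Φ q.2 - Φ p.2) * _ = _
      rw [edist_dist, ← ENNReal.ofReal_mul hL.le, Real.dist_eq, ← sub_div, abs_div, abs_of_pos hL,
        mul_div_cancel₀ _ hL.ne', sub_sub_sub_cancel_right]
    · refine Prod.ext ?_ (Subtype.ext (max_self _))
      simp only [ρ, sub_self, zero_div, h0]
    · refine Prod.ext ?_ (Subtype.ext (max_eq_left h1.le))
      simp only [ρ, div_self hL.ne', h1']

/-- Time along the curve is squeezed between its end values, and the displacement in `S` is at most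
the increase of `Φ`, small when those values are close to `t₀`. -/
theorem stronglyCausal_warpedMetric (hΦ : ∀ t, 0 < t → HasStrictDerivAt Φ (√(c / f t)) t) :
    (warpedMetric (n := n) S c hc f hf hf').StronglyCausal := by
  rintro ⟨x₀, t₀⟩ U hU
  rw [nhds_prod_eq] at hU
  obtain ⟨A, hA, B, hB, hAB⟩ := mem_prod_iff.1 hU
  obtain ⟨ε, ε0, hε⟩ := EMetric.mem_nhds_iff.1 hA
  obtain ⟨d, d0, hd⟩ := ENNReal.lt_iff_exists_nnreal_btwn.1 (ENNReal.half_pos ε0.ne')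
  have d0' : (0 : ℝ) < d := by exact_mod_cast (by simpa using d0 : 0 < d)
  have hΦc : ContinuousAt (fun t : PosHalfLine ↦ Φ t) t₀ :=
    (hΦ t₀ t₀.2).hasDerivAt.continuousAt.comp continuous_subtype_val.continuousAt
  -- Two values of `Φ` within `d / 2` of `Φ t₀` differ by less than `d < ε / 2`; the other `ε / 2`
  -- is spent on the distance from `x₀` to the start of the curve.
  have hB' : B ∩ {t : PosHalfLine | |Φ t - Φ t₀| < d / 2} ∈ 𝓝 t₀ :=
    inter_mem hB (hΦc (Metric.ball_mem_nhds _ (half_pos d0')))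
  obtain ⟨δ, δ0, hδ⟩ := Metric.mem_nhds_iff.1 hB'
  have hle : Metric.eball x₀ (ε / 2) ×ˢ Metric.ball t₀ δ ⊆ U := by
    refine (Set.prod_mono ?_ ?_).trans hAB
    · exact (Metric.eball_subset_eball ENNReal.half_le_self).trans hε
    · exact hδ.trans inter_subset_left
  refine ⟨Metric.eball x₀ (ε / 2) ×ˢ Metric.ball t₀ δ,
    prod_mem_nhds (Metric.eball_mem_nhds _ (ENNReal.half_pos ε0.ne')) (Metric.ball_mem_nhds _ δ0),
    hle, fun γ a b hab hγ ha hb s hs ↦ ?_⟩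
  rcases hs.1.eq_or_lt with rfl | has
  · exact hle ha
  have haJ : a ∈ Icc a b := ⟨le_rfl, hab.le⟩
  have hbJ : b ∈ Icc a b := ⟨hab.le, le_rfl⟩
  obtain ⟨h1, h2⟩ := lt_and_edist_le_of_isCausalCurve hΦ hγ haJ hs has
  have h3 : ((γ s).2 : ℝ) ≤ (γ b).2 := by
    rcases hs.2.eq_or_lt with rfl | hsb
    · exact le_rfl
    · exact (lt_and_edist_le_of_isCausalCurve hΦ hγ hs hbJ hsb).1.le
  have hta := ha.2
  have htb := hb.2
  have hts : (γ s).2 ∈ Metric.ball t₀ δ := by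
    rw [Metric.mem_ball, Subtype.dist_eq, Real.dist_eq, abs_lt] at hta htb ⊢
    constructor <;> linarith [hta.1, hta.2, htb.1, htb.2]
  refine hAB ⟨hε ?_, (hδ hts).1⟩
  have h4 : |Φ (γ s).2 - Φ t₀| < d / 2 := (hδ hts).2
  have h5 : |Φ (γ a).2 - Φ t₀| < d / 2 := (hδ hta).2
  rw [abs_lt] at h4 h5
  rw [Metric.mem_eball, edist_comm]
  refine (edist_triangle_left _ _ (γ a).1).trans_lt ?_
  rw [← ENNReal.add_halves ε]
  refine ENNReal.add_lt_add ha.1 ((h2.trans ?_).trans_lt hd)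
  rw [← ENNReal.ofReal_coe_nnreal]
  exact ENNReal.ofReal_le_ofReal (by linarith [h4.2, h5.1])

theorem globallyHyperbolic_warpedMetric [CompleteSpace S]
    (hΦ : ∀ t, 0 < t → HasStrictDerivAt Φ (√(c / f t)) t) :
    (warpedMetric (n := n) S c hc f hf hf').GloballyHyperbolic := by
  refine ⟨stronglyCausal_warpedMetric hΦ, fun p q ↦ ?_⟩
  have hmono := strictMonoOn_of_hasStrictDerivAt_sqrt hc hf hΦ
  have : LocallyCompactSpace S := ChartedSpace.locallyCompactSpace (EuclideanSpace ℝ (Fin n)) S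
  have hΦc : Continuous (fun t : PosHalfLine ↦ Φ t) := continuous_iff_continuousAt.2 fun t ↦
    (hΦ t t.2).hasDerivAt.continuousAt.comp continuous_subtype_val.continuousAt
  -- `p.2 > 0` keeps this interval away from the missing endpoint `0`.
  have hIcc : IsCompact (((↑) : PosHalfLine → ℝ) ⁻¹' Icc p.2 q.2) := by
    refine (IsInducing.subtypeVal.isCompact_preimage_iff ?_).2 isCompact_Icc
    rw [Subtype.range_coe]
    exact fun t ht ↦ p.2.2.trans_le ht.1
  have hball := (isLengthSpace_of_isRiemannianManifold n S).isCompact_closedEBall p.1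
    (Real.toNNReal (Φ q.2 - Φ p.2))
  refine (hball.prod hIcc).of_isClosed_subset ?_ ?_
  · simp only [TimeOrientedLorentzMetric.causalFuture, TimeOrientedLorentzMetric.causalPast,
      causalRel_warpedMetric_iff hΦ]
    have ht : Continuous (fun r : S × PosHalfLine ↦ (r.2 : ℝ)) :=
      continuous_subtype_val.comp continuous_snd
    have hΦt : Continuous (fun r : S × PosHalfLine ↦ Φ r.2) := hΦc.comp continuous_snd
    change IsClosed (({r : S × PosHalfLine | (p.2 : ℝ) ≤ r.2} ∩
      {r | edist p.1 r.1 ≤ ENNReal.ofReal (Φ r.2 - Φ p.2)}) ∩ ({r | (r.2 : ℝ) ≤ q.2} ∩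
      {r | edist r.1 q.1 ≤ ENNReal.ofReal (Φ q.2 - Φ r.2)}))
    refine ((isClosed_le continuous_const ht).inter (isClosed_le ?_ ?_)).inter
      ((isClosed_le ht continuous_const).inter (isClosed_le ?_ ?_))
    · exact continuous_const.edist continuous_fst
    · exact ENNReal.continuous_ofReal.comp (hΦt.sub continuous_const)
    · exact continuous_fst.edist continuous_const
    · exact ENNReal.continuous_ofReal.comp (continuous_const.sub hΦt)
  · rintro r ⟨h1, h2⟩
    obtain ⟨h3, h4⟩ := (causalRel_warpedMetric_iff hΦ).1 h1
    obtain ⟨h5, h6⟩ := (causalRel_warpedMetric_iff hΦ).1 h2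
    refine ⟨?_, h3, h5⟩
    rw [Metric.mem_closedEBall, edist_comm]
    refine h4.trans (ENNReal.ofReal_le_ofReal ?_)
    linarith [hmono.monotoneOn r.2.2 q.2.2 h5]

/-- If `t` converges in `ℝ₊` along a causal curve, then so does the curve. -/
lemma exists_tendsto_of_isCausalCurve [CompleteSpace S]
    (hΦ : ∀ t, 0 < t → HasStrictDerivAt Φ (√(c / f t)) t) {γ : ℝ → S × PosHalfLine} {J : Set ℝ}
    (hγ : (warpedMetric (n := n) S c hc f hf hf').IsCausalCurve γ J) {l : Filter J} [l.NeBot]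
    {τ : ℝ} (hτ : 0 < τ) (h : Tendsto (fun s : J ↦ ((γ s).2 : ℝ)) l (𝓝 τ)) :
    ∃ p, Tendsto (fun s : J ↦ γ s) l (𝓝 p) := by
  have hmono := (strictMonoOn_of_hasStrictDerivAt_sqrt hc hf hΦ).monotoneOn
  -- The component in `S` moves no more than `Φ ∘ t`, so it is Cauchy whenever `Φ ∘ t` is.
  have hdist : ∀ s r : J, edist (γ s).1 (γ r).1 ≤ edist (Φ (γ s).2) (Φ (γ r).2) := by
    have key : ∀ s r : J, s < r → edist (γ s).1 (γ r).1 ≤ edist (Φ (γ s).2) (Φ (γ r).2) := by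
      intro s r hsr
      obtain ⟨h1, h2⟩ := lt_and_edist_le_of_isCausalCurve hΦ hγ s.2 r.2 hsr
      rw [edist_dist, Real.dist_eq, abs_sub_comm]
      exact h2.trans (ENNReal.ofReal_le_ofReal (le_abs_self _))
    intro s r
    rcases lt_trichotomy s r with hsr | rfl | hsr
    · exact key s r hsr
    · simp
    · rw [edist_comm, edist_comm (Φ _)]
      exact key r s hsr
  have hcau : Cauchy (map (fun s : J ↦ Φ (γ s).2) l) :=
    ((hΦ τ hτ).hasDerivAt.continuousAt.tendsto.comp h).cauchy_map
  have hcau' : Cauchy (map (fun s : J ↦ (γ s).1) l) := by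
    rw [cauchy_map_iff] at hcau ⊢
    refine ⟨hcau.1, uniformity_basis_edist.tendsto_right_iff.2 fun ε ε0 ↦ ?_⟩
    filter_upwards [uniformity_basis_edist.tendsto_right_iff.1 hcau.2 ε ε0] with r hr
    exact (hdist _ _).trans_lt hr
  obtain ⟨x, hx⟩ := CompleteSpace.complete hcau'
  refine ⟨(x, ⟨τ, hτ⟩), ?_⟩
  rw [nhds_prod_eq]
  exact Tendsto.prodMk hx (tendsto_subtype_rng.2 h)

/-- Uniqueness is strict monotonicity of `t`. If `t` stayed on one side of `τ`, it would converge in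
`ℝ₊` at the corresponding end, producing a forbidden endpoint; existence is then the intermediate
value theorem. -/
theorem isCauchyHypersurface_timeSlice [CompleteSpace S]
    (hΦ : ∀ t, 0 < t → HasStrictDerivAt Φ (√(c / f t)) t) {τ : ℝ} (hτ : 0 < τ) :
    (warpedMetric (n := n) S c hc f hf hf').IsCauchyHypersurface (timeSlice S τ) := by
  rintro γ J ⟨hγ, hfut, hpast⟩
  have : Nonempty J := hγ.nontrivial.nonempty.to_subtype
  have hlt : ∀ s r : J, s < r → ((γ s).2 : ℝ) < (γ r).2 := fun s r hsr ↦
    (lt_and_edist_le_of_isCausalCurve hΦ hγ s.2 r.2 hsr).1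
  have hstrict : StrictMono (fun s : J ↦ ((γ s).2 : ℝ)) := fun s r hsr ↦ hlt s r hsr
  obtain ⟨s₁, hs₁⟩ : ∃ s : J, τ ≤ (γ s).2 := by
    by_contra! hcon
    have hb : BddAbove (range fun s : J ↦ ((γ s).2 : ℝ)) := ⟨τ, by
      rintro _ ⟨s, rfl⟩; exact (hcon s).le⟩
    have s : J := Classical.arbitrary J
    have hpos := (γ s).2.2.trans_le (le_ciSup hb s)
    obtain ⟨p, hp⟩ := exists_tendsto_of_isCausalCurve hΦ hγ hpos
      (tendsto_atTop_ciSup hstrict.monotone hb)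
    refine hfut ⟨p, fun U hU ↦ ?_⟩
    obtain ⟨s₀, hs₀⟩ := eventually_atTop.1 (hp hU)
    exact ⟨s₀, s₀.2, fun s hs hs' ↦ hs₀ ⟨s, hs⟩ hs'⟩
  obtain ⟨s₂, hs₂⟩ : ∃ s : J, (γ s).2 ≤ τ := by
    by_contra! hcon
    have hb : BddBelow (range fun s : J ↦ ((γ s).2 : ℝ)) := ⟨τ, by
      rintro _ ⟨s, rfl⟩; exact (hcon s).le⟩
    -- The infimum is at least `τ`, so the limit of `t` does not escape to `0`.
    have hpos := hτ.trans_le (le_ciInf fun s ↦ (hcon s).le)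
    obtain ⟨p, hp⟩ := exists_tendsto_of_isCausalCurve hΦ hγ hpos
      (tendsto_atBot_ciInf hstrict.monotone hb)
    refine hpast ⟨p, fun U hU ↦ ?_⟩
    obtain ⟨s₀, hs₀⟩ := eventually_atBot.1 (hp hU)
    exact ⟨s₀, s₀.2, fun s hs hs' ↦ hs₀ ⟨s, hs⟩ hs'⟩
  have hcont : ContinuousOn (fun s ↦ ((γ s).2 : ℝ)) J :=
    (continuous_subtype_val.comp continuous_snd).comp_continuousOn hγ.continuousOn
  obtain ⟨s, hs, hsτ⟩ :=
    hγ.ordConnected.isPreconnected.intermediate_value s₂.2 s₁.2 hcont ⟨hs₂, hs₁⟩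
  refine ⟨s, ⟨hs, hsτ⟩, fun r hr ↦ ?_⟩
  exact congrArg Subtype.val (hstrict.injective (a₁ := ⟨r, hr.1⟩) (a₂ := ⟨s, hs⟩)
    (Eq.trans hr.2 hsτ.symm))

end WarpedProduct

end MetricGeometry

theorem lemma6p3 (n : ℕ) (hn : 2 ≤ n)
    (S : Type*) [EMetricSpace S] [ChartedSpace (EuclideanSpace ℝ (Fin n)) S]
    [IsManifold (𝓡 n) ∞ S]
    [RiemannianBundle (fun x : S ↦ TangentSpace (𝓡 n) x)]
    [IsContMDiffRiemannianBundle (𝓡 n) ∞ (EuclideanSpace ℝ (Fin n))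
      (fun x : S ↦ TangentSpace (𝓡 n) x)]
    [IsRiemannianManifold (𝓡 n) S] [CompleteSpace S] :
    ((metricQ S hn).GloballyHyperbolic ∧
      ∀ τ : ℝ, 0 < τ → (metricQ S hn).IsCauchyHypersurface (timeSlice S τ)) ∧
    ((metricQTilde S hn).GloballyHyperbolic ∧
      ∀ τ : ℝ, 0 < τ → (metricQTilde S hn).IsCauchyHypersurface (timeSlice S τ)) := by
  have key : ∀ (c : ℝ) (hc : 0 < c) (f : ℝ → ℝ) (hf : ∀ t, 0 < t → 0 < f t)
      (hf' : ContDiffOn ℝ ∞ f (Ioi 0)),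
      (warpedMetric (n := n) S c hc f hf hf').GloballyHyperbolic ∧ ∀ τ : ℝ, 0 < τ →
        (warpedMetric (n := n) S c hc f hf hf').IsCauchyHypersurface (timeSlice S τ) := by
    intro c hc f hf hf'
    obtain ⟨Φ, hΦ⟩ := exists_hasStrictDerivAt_sqrt (c := c) hf hf'
    exact ⟨globallyHyperbolic_warpedMetric hΦ, fun τ hτ ↦ isCauchyHypersurface_timeSlice hΦ hτ⟩
  exact ⟨key _ _ _ _ _, key _ _ _ _ _⟩
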